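/- Let $(\Omega_1,\nu)$ and $(\Omega_2,\mu)$ be $\sigma$-finite, complete measure spaces; all function spaces are real. For a $\sigma$-finite measure space $(\Omega,\nu)$ let $\mathcal P(\Omega,\nu)$ be the set of measurable functions $p:\Omega\to[1,\infty]$, and let $\mathcal P_b(\Omega,\nu)$ be the set of those $p\in\mathcal P(\Omega,\nu)$ with $1<\operatorname{ess\,inf}p\le\operatorname{ess\,sup}p<\infty$. For $p(\cdot)\in\mathcal P(\Omega,\nu)$ put $$\rho_{p(\cdot)}(f)=\int_{\{p<\infty\}}|f(x)|^{p(x)}\,d\nu(x)+\|f\|_{L^\infty(\{p=\infty\})},$$ let $L^{p(\cdot)}(\Omega,\nu)$ be the space of (classes of) measurable functions $f$ with $\rho_{p(\cdot)}(f/\lambda)<\infty$ for some $\lambda>0$, and norm it by $\|f\|_{L^{p(\cdot)}(\Omega,\nu)}=\inf\{\lambda>0:\rho_{p(\cdot)}(f/\lambda)\le 1\}$. For $q(\cdot)\in\mathcal P(\Omega_2,\mu)$, $p(\cdot)\in\mathcal P(\Omega_1,\nu)$ and $1\le r<\infty$, let $k_{q(\cdot),p(\cdot)}(r)\in[1,\infty]$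 be the infimum of all constants $C\ge 1$ such that $$\Big\|\Big(\sum_{k=1}^N|T(f_k)|^r\Big)^{1/r}\Big\|_{L^{p(\cdot)}(\Omega_1,\nu)}\le C\,\|T\|\,\Big\|\Big(\sum_{k=1}^N|f_k|^r\Big)^{1/r}\Big\|_{L^{q(\cdot)}(\Omega_2,\mu)}$$ for every bounded linear operator $T:L^{q(\cdot)}(\Omega_2,\mu)\to L^{p(\cdot)}(\Omega_1,\nu)$, every $N\in\mathbb N$ and all $f_1,\dots,f_N\in L^{q(\cdot)}(\Omega_2,\mu)$ (with $k_{q(\cdot),p(\cdot)}(r)=\infty$ if there is no such $C$). **Theorem.** Let $p(\cdot),p_1(\cdot),p_2(\cdot)\in\mathcal P_b(\Omega_1,\nu)$, let $q_1(\cdot),q_2(\cdot)\in\mathcal P_b(\Omega_2,\mu)$, let $q(\cdot)\in\mathcal P(\Omega_2,\mu)$ be arbitrary, and let $1\le r<\infty$. Then: 1. If $1\le r<s\le 2$, then $k_{q(\cdot),p(\cdot)}(s)\le k_{q(\cdot),p(\cdot)}(r)$. 2. If $2\le r<s<\infty$, then $k_{q(\cdot),p(\cdot)}(r)\le 2^4\,k_{q(\cdot),p(\cdot)}(s)$.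 3. If $p_2(\cdot)\le p_1(\cdot)$ almost everywhere, then $k_{q(\cdot),p_1(\cdot)}(r)\le(2^3+1)\,k_{q(\cdot),p_2(\cdot)}(r)$. 4. If $q_1(\cdot)\le q_2(\cdot)$ almost everywhere, then $k_{q_1(\cdot),p(\cdot)}(r)\le(2^7+2^4)\,k_{q_2(\cdot),p(\cdot)}(r)$. -/

import Mathlib

open MeasureTheory
open scoped ENNReal NNReal

/-- A variable exponent: a measurable function `p : Ω → [1, ∞]`. -/
structure VarExponent (Ω : Type*) [MeasurableSpace Ω] where
  toFun : Ω → ℝ≥0∞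
  measurable' : Measurable toFun
  one_le' : ∀ x, 1 ≤ toFun x

namespace VarExponent

instance {Ω : Type*} [MeasurableSpace Ω] : CoeFun (VarExponent Ω) (fun _ => Ω → ℝ≥0∞) :=
  ⟨VarExponent.toFun⟩

/-- The class `𝒫_b(Ω, ν)`: the exponent satisfies `1 < p₋` and `p₊ < ∞`. (The inequality
`p₋ ≤ p₊` is automatic for a nonzero measure.) -/
def IsBdd {Ω : Type*} [MeasurableSpace Ω] (p : VarExponent Ω) (ν : Measure Ω) : Prop :=
  1 < essInf p ν ∧ essSup p ν < ∞

end VarExponent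

/-- The modular `ρ_{p(·)}(f) = ∫_{p < ∞} |f(x)|^{p(x)} dν(x) + ‖f‖_{L^∞({p = ∞})}`. -/
noncomputable def varModular {Ω : Type*} [MeasurableSpace Ω] (p : VarExponent Ω)
    (ν : Measure Ω) (f : Ω → ℝ) : ℝ≥0∞ :=
  (∫⁻ x in {x | p x ≠ ∞}, ‖f x‖ₑ ^ (p x).toReal ∂ν) +
    essSup (fun x => ‖f x‖ₑ) (ν.restrict {x | p x = ∞})

/-- The Luxemburg norm `inf {c > 0 : ρ_{p(·)}(f / c) ≤ 1}`, with values in `[0, ∞]`. -/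
noncomputable def varENorm {Ω : Type*} [MeasurableSpace Ω] (p : VarExponent Ω)
    (ν : Measure Ω) (f : Ω → ℝ) : ℝ≥0∞ :=
  ⨅ (c : ℝ) (_ : 0 < c) (_ : varModular p ν (fun x => f x / c) ≤ 1), ENNReal.ofReal c

section helpers

variable {Ω : Type*} [MeasurableSpace Ω] {p : VarExponent Ω} {ν : Measure Ω}

theorem VarExponent.one_le_toReal {x : Ω} (h : p x ≠ ∞) : 1 ≤ (p x).toReal := by
  have := ENNReal.toReal_mono h (p.one_le' x)
  simpa using this

theorem VarExponent.measurableSet_ne_top : MeasurableSet {x | p x ≠ ∞} :=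
  (p.measurable' (measurableSet_singleton ∞)).compl

theorem VarExponent.measurableSet_eq_top : MeasurableSet {x | p x = ∞} :=
  p.measurable' (measurableSet_singleton ∞)

theorem varModular_mono {f g : Ω → ℝ} (h : ∀ᵐ x ∂ν, ‖f x‖ₑ ≤ ‖g x‖ₑ) :
    varModular p ν f ≤ varModular p ν g := by
  unfold varModular
  refine add_le_add (lintegral_mono_ae ?_) (essSup_mono_ae (ae_restrict_of_ae h))
  filter_upwards [ae_restrict_of_ae h] with x hx
  exact ENNReal.rpow_le_rpow hx ENNReal.toReal_nonneg

theorem varModular_congr {f g : Ω → ℝ} (h : f =ᵐ[ν] g) :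
    varModular p ν f = varModular p ν g :=
  le_antisymm (varModular_mono (h.mono fun x hx => by rw [hx]))
    (varModular_mono (h.mono fun x hx => by rw [hx]))

theorem varENorm_congr {f g : Ω → ℝ} (h : f =ᵐ[ν] g) : varENorm p ν f = varENorm p ν g := by
  unfold varENorm
  have : ∀ c : ℝ, varModular p ν (fun x => f x / c) = varModular p ν (fun x => g x / c) :=
    fun c => varModular_congr (h.mono fun x hx => by simp only [hx])
  simp only [this]

theorem varModular_zero : varModular p ν (fun _ => 0) = 0 := by
  unfold varModular
  have h1 : (∫⁻ x in {x | p x ≠ ∞}, ‖(0 : ℝ)‖ₑ ^ (p x).toReal ∂ν) = 0 := by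
    rw [lintegral_eq_zero_of_ae_eq_zero]
    filter_upwards [ae_restrict_mem VarExponent.measurableSet_ne_top] with x hx
    have := VarExponent.one_le_toReal hx
    simp only [enorm_zero, Pi.zero_apply]
    exact ENNReal.zero_rpow_of_pos (by linarith)
  rw [h1]
  have h2 : essSup (fun _ : Ω => ‖(0 : ℝ)‖ₑ) (ν.restrict {x | p x = ∞}) = 0 := by
    simp only [enorm_zero]
    exact essSup_const_bot
  rw [h2, add_zero]

/-- Convexity of the modular. -/
theorem varModular_convex {f g : Ω → ℝ} (hf : AEMeasurable f ν)
    {a b : ℝ} (ha : 0 ≤ a) (hb : 0 ≤ b) (hab : a + b = 1) :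
    varModular p ν (fun x => a * f x + b * g x) ≤
      ENNReal.ofReal a * varModular p ν f + ENNReal.ofReal b * varModular p ν g := by
  have hE : ENNReal.ofReal a + ENNReal.ofReal b = 1 := by
    rw [← ENNReal.ofReal_add ha hb, hab, ENNReal.ofReal_one]
  have hpt : ∀ x, ‖a * f x + b * g x‖ₑ ≤
      ENNReal.ofReal a * ‖f x‖ₑ + ENNReal.ofReal b * ‖g x‖ₑ := by
    intro x
    refine (enorm_add_le _ _).trans ?_
    rw [enorm_mul, enorm_mul, Real.enorm_of_nonneg ha, Real.enorm_of_nonneg hb]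
  have hm : AEMeasurable (fun x => ENNReal.ofReal a * ‖f x‖ₑ ^ (p x).toReal)
      (ν.restrict {x | p x ≠ ∞}) :=
    ((hf.restrict.enorm).pow p.measurable'.ennreal_toReal.aemeasurable).const_mul _
  have h1 : (∫⁻ x in {x | p x ≠ ∞}, ‖a * f x + b * g x‖ₑ ^ (p x).toReal ∂ν) ≤
      ENNReal.ofReal a * (∫⁻ x in {x | p x ≠ ∞}, ‖f x‖ₑ ^ (p x).toReal ∂ν) +
      ENNReal.ofReal b * (∫⁻ x in {x | p x ≠ ∞}, ‖g x‖ₑ ^ (p x).toReal ∂ν) := by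
    rw [← lintegral_const_mul' _ _ ENNReal.ofReal_ne_top,
      ← lintegral_const_mul' _ _ ENNReal.ofReal_ne_top, ← lintegral_add_left' hm]
    refine lintegral_mono_ae ?_
    filter_upwards [ae_restrict_mem VarExponent.measurableSet_ne_top] with x hx
    refine (ENNReal.rpow_le_rpow (hpt x) ENNReal.toReal_nonneg).trans ?_
    exact ENNReal.rpow_arith_mean_le_arith_mean2_rpow _ _ _ _ hE (VarExponent.one_le_toReal hx)
  have h2 : essSup (fun x => ‖a * f x + b * g x‖ₑ) (ν.restrict {x | p x = ∞}) ≤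
      ENNReal.ofReal a * essSup (fun x => ‖f x‖ₑ) (ν.restrict {x | p x = ∞}) +
      ENNReal.ofReal b * essSup (fun x => ‖g x‖ₑ) (ν.restrict {x | p x = ∞}) := by
    refine essSup_le_of_ae_le _ ?_
    filter_upwards [ENNReal.ae_le_essSup (μ := ν.restrict {x | p x = ∞}) (fun x => ‖f x‖ₑ),
      ENNReal.ae_le_essSup (μ := ν.restrict {x | p x = ∞}) (fun x => ‖g x‖ₑ)] with x h h'
    refine (hpt x).trans ?_
    gcongr
  unfold varModular
  refine (add_le_add h1 h2).trans (le_of_eq ?_)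
  ring

theorem varModular_mul_le {f : Ω → ℝ} (hf : AEMeasurable f ν) {a : ℝ} (ha : 0 ≤ a) (ha1 : a ≤ 1) :
    varModular p ν (fun x => a * f x) ≤ ENNReal.ofReal a * varModular p ν f := by
  have := varModular_convex (p := p) (g := fun _ => 0) hf ha (sub_nonneg.2 ha1) (by ring)
  simpa [varModular_zero] using this

theorem varModular_div_le_one_of_le {f : Ω → ℝ} {c d : ℝ} (hc : 0 < c) (hcd : c ≤ d)
    (h : varModular p ν (fun x => f x / c) ≤ 1) : varModular p ν (fun x => f x / d) ≤ 1 := by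
  refine (varModular_mono (Filter.Eventually.of_forall fun x => ?_)).trans h
  rw [enorm_le_iff_norm_le, norm_div, norm_div, Real.norm_of_nonneg hc.le,
    Real.norm_of_nonneg (hc.le.trans hcd)]
  gcongr

theorem varENorm_le {f : Ω → ℝ} {c : ℝ} (hc : 0 < c)
    (h : varModular p ν (fun x => f x / c) ≤ 1) : varENorm p ν f ≤ ENNReal.ofReal c :=
  iInf_le_of_le c (iInf_le_of_le hc (iInf_le _ h))

theorem exists_of_varENorm_lt {f : Ω → ℝ} {b : ℝ≥0∞} (h : varENorm p ν f < b) :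
    ∃ c : ℝ, 0 < c ∧ varModular p ν (fun x => f x / c) ≤ 1 ∧ ENNReal.ofReal c < b := by
  unfold varENorm at h
  simp only [iInf_lt_iff] at h
  obtain ⟨c, hc, h1, h2⟩ := h
  exact ⟨c, hc, h1, h2⟩

theorem varModular_div_le_one {f : Ω → ℝ} {c : ℝ}
    (h : varENorm p ν f < ENNReal.ofReal c) : varModular p ν (fun x => f x / c) ≤ 1 := by
  obtain ⟨d, hd, h1, h2⟩ := exists_of_varENorm_lt h
  exact varModular_div_le_one_of_le hd
    ((ENNReal.ofReal_lt_ofReal_iff_of_nonneg hd.le).1 h2).le h1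

/-- The Luxemburg norm is finite exactly when the modular of some `f / c` is finite. -/
theorem varENorm_lt_top_iff {f : Ω → ℝ} (hf : AEMeasurable f ν) :
    varENorm p ν f < ∞ ↔ ∃ c : ℝ, 0 < c ∧ varModular p ν (fun x => f x / c) < ∞ := by
  constructor
  · intro h
    obtain ⟨c, hc, h1, -⟩ := exists_of_varENorm_lt h
    exact ⟨c, hc, h1.trans_lt ENNReal.one_lt_top⟩
  · rintro ⟨c, hc, h⟩
    set M : ℝ := (varModular p ν (fun x => f x / c)).toReal with hM
    have hM0 : 0 ≤ M := ENNReal.toReal_nonneg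
    have hpos : 0 < M + 1 := by linarith
    have key : varModular p ν (fun x => f x / (c * (M + 1))) ≤ 1 := by
      have h1 := varModular_mul_le (p := p) (a := (M + 1)⁻¹) (hf.div_const c) (by positivity)
        (inv_le_one_of_one_le₀ (by linarith))
      have h2 : (fun x => (M + 1)⁻¹ * (f x / c)) = fun x => f x / (c * (M + 1)) := by
        funext x
        field_simp
      rw [h2] at h1
      refine h1.trans ?_
      rw [← ENNReal.ofReal_toReal h.ne, ← hM, ← ENNReal.ofReal_mul (by positivity),
        ENNReal.ofReal_le_one, inv_mul_le_iff₀ hpos]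
      linarith
    exact (varENorm_le (by positivity) key).trans_lt ENNReal.ofReal_lt_top

theorem varENorm_zero : varENorm p ν (fun _ => 0) = 0 := by
  refine le_antisymm (ENNReal.le_of_forall_pos_le_add fun e he _ => ?_) bot_le
  have := varENorm_le (p := p) (ν := ν) (f := fun _ => 0) (c := e) (by exact_mod_cast he)
    (by simp [varModular_zero])
  simpa using this

theorem varENorm_const_mul_le {f : Ω → ℝ} {a : ℝ} (ha : a ≠ 0) :
    varENorm p ν (fun x => a * f x) ≤ ‖a‖ₑ * varENorm p ν f := by
  have hane : ‖a‖ₑ ≠ 0 := by simpa using ha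
  rw [mul_comm, ← ENNReal.div_le_iff_le_mul (Or.inl hane) (Or.inl enorm_ne_top)]
  refine le_iInf fun c => le_iInf fun hc => le_iInf fun h => ?_
  rw [ENNReal.div_le_iff_le_mul (Or.inl hane) (Or.inl enorm_ne_top), ← ofReal_norm,
    ← ENNReal.ofReal_mul hc.le]
  refine varENorm_le (mul_pos hc (norm_pos_iff.2 ha)) ?_
  refine (varModular_mono (Filter.Eventually.of_forall fun x => ?_)).trans h
  rw [enorm_le_iff_norm_le, norm_div, norm_div, norm_mul, norm_mul, norm_norm, mul_comm,
    mul_div_mul_right _ _ (norm_ne_zero_iff.2 ha)]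

theorem varENorm_const_mul {f : Ω → ℝ} (a : ℝ) :
    varENorm p ν (fun x => a * f x) = ‖a‖ₑ * varENorm p ν f := by
  rcases eq_or_ne a 0 with rfl | ha
  · simp [varENorm_zero]
  · refine le_antisymm (varENorm_const_mul_le ha) ?_
    have h := varENorm_const_mul_le (p := p) (ν := ν) (f := fun x => a * f x) (inv_ne_zero ha)
    simp only [inv_mul_cancel_left₀ ha] at h
    calc ‖a‖ₑ * varENorm p ν f ≤ ‖a‖ₑ * (‖a⁻¹‖ₑ * varENorm p ν fun x => a * f x) := by gcongr
      _ = varENorm p ν fun x => a * f x := by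
        rw [← mul_assoc, ← enorm_mul, mul_inv_cancel₀ ha]
        simp

theorem varENorm_add_le {f g : Ω → ℝ} (hf : AEMeasurable f ν) :
    varENorm p ν (fun x => f x + g x) ≤ varENorm p ν f + varENorm p ν g := by
  refine ENNReal.le_of_forall_pos_le_add fun e he hfin => ?_
  have hff : varENorm p ν f ≠ ∞ := (le_self_add.trans_lt hfin).ne
  have hgf : varENorm p ν g ≠ ∞ := (le_add_self.trans_lt hfin).ne
  have he2 : ((e / 2 : ℝ≥0) : ℝ≥0∞) ≠ 0 := by
    simpa using he.ne'
  obtain ⟨c, hc, h1, h2⟩ := exists_of_varENorm_lt (ENNReal.lt_add_right hff he2)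
  obtain ⟨d, hd, h3, h4⟩ := exists_of_varENorm_lt (ENNReal.lt_add_right hgf he2)
  have key : varModular p ν (fun x => (f x + g x) / (c + d)) ≤ 1 := by
    have h := varModular_convex (p := p) (g := fun x => g x / d) (hf.div_const c)
      (a := c / (c + d)) (b := d / (c + d)) (by positivity) (by positivity) (by field_simp)
    have h2 : (fun x => c / (c + d) * (f x / c) + d / (c + d) * (g x / d)) =
        fun x => (f x + g x) / (c + d) := by
      funext x
      field_simp
    rw [h2] at h
    refine h.trans ((add_le_add (mul_le_mul_right h1 _) (mul_le_mul_right h3 _)).trans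
      (le_of_eq ?_))
    rw [mul_one, mul_one, ← ENNReal.ofReal_add (by positivity) (by positivity), ← add_div,
      div_self (by positivity), ENNReal.ofReal_one]
  refine (varENorm_le (by positivity) key).trans ?_
  rw [ENNReal.ofReal_add hc.le hd.le]
  refine (add_le_add h2.le h4.le).trans (le_of_eq ?_)
  have : (e : ℝ≥0∞) = ((e / 2 : ℝ≥0) : ℝ≥0∞) + ((e / 2 : ℝ≥0) : ℝ≥0∞) := by
    rw [← ENNReal.coe_add, add_halves]
  rw [this]
  ring

theorem ae_eq_zero_of_varENorm_eq_zero {f : Ω → ℝ} (hf : AEMeasurable f ν)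
    (h : varENorm p ν f = 0) : f =ᵐ[ν] fun _ => 0 := by
  have hmod : varModular p ν f = 0 := by
    refine le_antisymm (ENNReal.le_of_forall_pos_le_add fun e he _ => ?_) bot_le
    rw [zero_add]
    set d : ℝ := min e 1 with hd
    have hd0 : 0 < d := lt_min (by exact_mod_cast he) one_pos
    have h1 : varModular p ν (fun x => f x / d) ≤ 1 :=
      varModular_div_le_one (by rw [h]; simpa using hd0)
    have h2 := varModular_mul_le (p := p) (hf.div_const d) hd0.le (min_le_right _ _)
    have h3 : (fun x => d * (f x / d)) = f := by
      funext x
      field_simp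
    rw [h3] at h2
    refine h2.trans ((mul_le_mul_right h1 _).trans ?_)
    rw [mul_one]
    refine (ENNReal.ofReal_le_ofReal (min_le_left _ _)).trans ?_
    simp
  unfold varModular at hmod
  obtain ⟨h1, h2⟩ := add_eq_zero.1 hmod
  have hm : AEMeasurable (fun x => ‖f x‖ₑ ^ (p x).toReal) (ν.restrict {x | p x ≠ ∞}) :=
    (hf.restrict.enorm).pow p.measurable'.ennreal_toReal.aemeasurable
  rw [lintegral_eq_zero_iff' hm] at h1
  have h1' := (ae_restrict_iff' VarExponent.measurableSet_ne_top).1 h1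
  have h2' := (ae_restrict_iff' VarExponent.measurableSet_eq_top).1
    (ENNReal.ae_le_essSup (μ := ν.restrict {x | p x = ∞}) (fun x => ‖f x‖ₑ))
  filter_upwards [h1', h2'] with x hx1 hx2
  by_cases hx : p x = ∞
  · have := hx2 hx
    rw [h2] at this
    simpa using this
  · have := hx1 hx
    have hp := VarExponent.one_le_toReal hx
    simp only [Pi.zero_apply] at this
    rcases ENNReal.rpow_eq_zero_iff.1 this with h | h
    · simpa using h.1
    · linarith

end helpers

/-- The variable Lebesgue space `L^{p(·)}(Ω, ν)` as a linear subspace of the space of classes of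
a.e. equal real functions: those `f` with `ρ_{p(·)}(f / c) < ∞` for some `c > 0`. -/
def varLpSubmodule {Ω : Type*} [MeasurableSpace Ω] (p : VarExponent Ω) (ν : Measure Ω) :
    Submodule ℝ (Ω →ₘ[ν] ℝ) where
  carrier := {f | ∃ c : ℝ, 0 < c ∧ varModular p ν (fun x => f x / c) < ∞}
  zero_mem' := by
    have h : ((0 : Ω →ₘ[ν] ℝ) : Ω → ℝ) =ᵐ[ν] fun _ => 0 := AEEqFun.coeFn_zero
    rw [Set.mem_ofPred_eq, ← varENorm_lt_top_iff (AEEqFun.aemeasurable _), varENorm_congr h,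
      varENorm_zero]
    exact ENNReal.zero_lt_top
  add_mem' := by
    intro f g hf hg
    have h : ((f + g : Ω →ₘ[ν] ℝ) : Ω → ℝ) =ᵐ[ν] fun x => f x + g x := AEEqFun.coeFn_add f g
    rw [Set.mem_ofPred_eq, ← varENorm_lt_top_iff (AEEqFun.aemeasurable _)] at hf hg ⊢
    rw [varENorm_congr h]
    exact (varENorm_add_le (AEEqFun.aemeasurable _)).trans_lt (ENNReal.add_lt_top.2 ⟨hf, hg⟩)
  smul_mem' := by
    intro a f hf
    have h : ((a • f : Ω →ₘ[ν] ℝ) : Ω → ℝ) =ᵐ[ν] fun x => a * f x := AEEqFun.coeFn_smul a f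
    rw [Set.mem_ofPred_eq, ← varENorm_lt_top_iff (AEEqFun.aemeasurable _)] at hf ⊢
    rw [varENorm_congr h, varENorm_const_mul]
    exact ENNReal.mul_lt_top enorm_lt_top hf

/-- The variable Lebesgue space `L^{p(·)}(Ω, ν)`. -/
def VarLp {Ω : Type*} [MeasurableSpace Ω] (p : VarExponent Ω) (ν : Measure Ω) : Type _ :=
  varLpSubmodule p ν

namespace VarLp

variable {Ω : Type*} [MeasurableSpace Ω] {p : VarExponent Ω} {ν : Measure Ω}

noncomputable instance : AddCommGroup (VarLp p ν) :=
  inferInstanceAs (AddCommGroup (varLpSubmodule p ν))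

noncomputable instance : Module ℝ (VarLp p ν) :=
  inferInstanceAs (Module ℝ (varLpSubmodule p ν))

/-- An element of `L^{p(·)}` as a class of a.e. equal functions. -/
def toAEEqFun (f : VarLp p ν) : Ω →ₘ[ν] ℝ := f.1

/-- A representative of an element of `L^{p(·)}`. -/
noncomputable instance : CoeFun (VarLp p ν) (fun _ => Ω → ℝ) :=
  ⟨fun f => (f.toAEEqFun : Ω → ℝ)⟩

/-- The Luxemburg norm on `L^{p(·)}`, where it is finite. -/
noncomputable instance : Norm (VarLp p ν) := ⟨fun f => (varENorm p ν f).toReal⟩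

theorem norm_def (f : VarLp p ν) : ‖f‖ = (varENorm p ν f).toReal := rfl

theorem varENorm_lt_top (f : VarLp p ν) : varENorm p ν f < ∞ :=
  (varENorm_lt_top_iff (AEEqFun.aemeasurable _)).2 f.2

theorem normedSpaceCore : NormedSpace.Core ℝ (VarLp p ν) where
  norm_nonneg f := ENNReal.toReal_nonneg
  norm_smul a f := by
    have h : ((a • f : VarLp p ν) : Ω → ℝ) =ᵐ[ν] fun x => a * f x :=
      AEEqFun.coeFn_smul a f.toAEEqFun
    rw [norm_def, norm_def, varENorm_congr h, varENorm_const_mul, ENNReal.toReal_mul,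
      toReal_enorm]
  norm_triangle f g := by
    have h : ((f + g : VarLp p ν) : Ω → ℝ) =ᵐ[ν] fun x => f x + g x :=
      AEEqFun.coeFn_add f.toAEEqFun g.toAEEqFun
    rw [norm_def, norm_def, norm_def, varENorm_congr h,
      ← ENNReal.toReal_add f.varENorm_lt_top.ne g.varENorm_lt_top.ne]
    exact ENNReal.toReal_mono (ENNReal.add_ne_top.2 ⟨f.varENorm_lt_top.ne, g.varENorm_lt_top.ne⟩)
      (varENorm_add_le (AEEqFun.aemeasurable _))
  norm_eq_zero_iff f := by
    rw [norm_def, ENNReal.toReal_eq_zero_iff, or_iff_left f.varENorm_lt_top.ne]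
    constructor
    · intro h
      have h0 := ae_eq_zero_of_varENorm_eq_zero (AEEqFun.aemeasurable _) h
      exact Subtype.ext (AEEqFun.ext (h0.trans AEEqFun.coeFn_zero.symm))
    · rintro rfl
      have h : ((0 : VarLp p ν) : Ω → ℝ) =ᵐ[ν] fun _ => 0 := AEEqFun.coeFn_zero
      rw [varENorm_congr h, varENorm_zero]

noncomputable instance : NormedAddCommGroup (VarLp p ν) :=
  NormedAddCommGroup.ofCore normedSpaceCore

noncomputable instance : NormedSpace ℝ (VarLp p ν) :=
  NormedSpace.ofCore normedSpaceCore

end VarLp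

/-- The function `x ↦ (∑ₖ |fₖ(x)|^r)^{1/r}`. -/
noncomputable def ellrFun {Ω : Type*} {N : ℕ} (r : ℝ) (f : Fin N → Ω → ℝ) : Ω → ℝ :=
  fun x => (∑ k, |f k x| ^ r) ^ (1 / r)

/-- `C` is a constant in the `ℓ^r`-valued inequality: for every bounded linear operator
`T : L^{q(·)}(Ω₂, μ) → L^{p(·)}(Ω₁, ν)` and every finite sequence `(fₖ)` in `L^{q(·)}(Ω₂, μ)`,
`‖(∑ |T fₖ|^r)^{1/r}‖_{p(·)} ≤ C ‖T‖ ‖(∑ |fₖ|^r)^{1/r}‖_{q(·)}`. -/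
def IsMZBound {Ω₁ Ω₂ : Type*} [MeasurableSpace Ω₁] [MeasurableSpace Ω₂]
    (μ : Measure Ω₂) (ν : Measure Ω₁) (q : VarExponent Ω₂) (p : VarExponent Ω₁)
    (r : ℝ) (C : ℝ≥0) : Prop :=
  ∀ (T : VarLp q μ →L[ℝ] VarLp p ν) (N : ℕ) (f : Fin N → VarLp q μ),
    varENorm p ν (ellrFun r fun k => T (f k)) ≤
      C * ‖T‖ₑ * varENorm q μ (ellrFun r fun k => f k)

/-- The constant `k_{q(·),p(·)}(r)`: the infimum of all `C ≥ 1` as in `IsMZBound`, which is `∞`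
if there is no such `C`. -/
noncomputable def mzConst {Ω₁ Ω₂ : Type*} [MeasurableSpace Ω₁] [MeasurableSpace Ω₂]
    (μ : Measure Ω₂) (ν : Measure Ω₁) (q : VarExponent Ω₂) (p : VarExponent Ω₁)
    (r : ℝ) : ℝ≥0∞ :=
  ⨅ (C : ℝ≥0) (_ : 1 ≤ C) (_ : IsMZBound μ ν q p r C), (C : ℝ≥0∞)

/-! Parts 3 and 4 rest on a change of exponent by a pointwise multiplier. If `q ≤ p`, `F ≥ 0` and
`ρ_p(F) ≤ K`, then multiplication by `F ^ (p / q - 1)` maps `L^p` to `L^q` with norm at most `K + 1`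
(`varENorm_multiplier_le`), and it sends `F` itself to `F ^ (p / q)`, whose `q`-modular is `ρ_p(F)`.
A multiplier also passes through the pointwise `ℓ^r`-norm. Composing `T` on the left with the
multiplier built from `(∑ |T fₖ|^r)^{1/r}` raises the target exponent (`IsMZBound.of_target_le`,
constant 3). Factoring the `fₖ` through the multiplier built from `(∑ |fₖ|^r)^{1/r}` and composing
on the right lowers the source exponent (`IsMZBound.of_source_le`, constant 2).

Parts 1 and 2 rest on the embedding of `ℓ^s` into `L^r` for `r < s ≤ 2`. For independent symmetric
`s`-stable variables, the `r`-th moment of `∑ aₖ gₖ` is a constant times `‖a‖_s ^ r`. Only a finite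
approximation is needed, so normalised sums in the domain of attraction of the stable law replace
it. Their moments are computed from characteristic functions through `∫₀^∞ (1 - cos (y t)) t^{-1-r}
dt = |y|^r cosKernel r`, and they converge uniformly on the unit sphere of `ℓ^s`
(`exists_moment_approx_of_lt`). Replacing the random vector by a simple function gives a matrix
embedding `ℓ^s` into a finite-dimensional `ℓ^r` up to a factor `1 + ε`
(`exists_almost_isometric_embedding`). A linear `T` commutes with this matrix, which proves part 1
with no loss after `ε → 0`.

Part 2 is dual: for `2 ≤ r < s` the conjugate exponents satisfy `s' < r' ≤ 2`, so the transpose of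
an embedding `ℓ^{r'} → ℓ^{s'}` is a quotient map `ℓ^s → ℓ^r`. The vector `(fₖ(x))` is lifted
measurably in `x` (`exists_measurable_lift`, factor 2), the bound for `s` is applied to the lift,
and the transpose brings the result back (another factor 2). -/

section modular

/-! ### Comparison of modulars for two exponents -/

variable {Ω : Type*} [MeasurableSpace Ω] {p q : VarExponent Ω} {ν : Measure Ω}

theorem varENorm_mono {f g : Ω → ℝ} (h : ∀ᵐ x ∂ν, |f x| ≤ |g x|) :
    varENorm p ν f ≤ varENorm p ν g := by
  unfold varENorm
  refine iInf_mono fun c => iInf_mono fun hc => iInf_mono' fun h1 => ⟨?_, le_rfl⟩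
  refine (varModular_mono (h.mono fun x hx => ?_)).trans h1
  rw [enorm_le_iff_norm_le, norm_div, norm_div, Real.norm_eq_abs, Real.norm_eq_abs]
  gcongr
  exact hx

theorem varENorm_abs {f : Ω → ℝ} : varENorm p ν (fun x => |f x|) = varENorm p ν f :=
  le_antisymm (varENorm_mono (by simp)) (varENorm_mono (by simp))

theorem varENorm_sum_le {ι : Type*} (S : Finset ι) {f : ι → Ω → ℝ}
    (hf : ∀ i ∈ S, AEMeasurable (f i) ν) :
    varENorm p ν (fun x => ∑ i ∈ S, f i x) ≤ ∑ i ∈ S, varENorm p ν (f i) := by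
  classical
  induction S using Finset.induction_on with
  | empty => simp [varENorm_zero]
  | insert i S hi ih =>
    simp only [Finset.sum_insert hi]
    exact (varENorm_add_le (hf i (by simp))).trans
      (by gcongr; exact ih fun j hj => hf j (Finset.mem_insert_of_mem hj))

/-- By convexity and `ρ(0) = 0`, dividing the function by `K ≥ 1` divides the modular by at least
`K`. -/
theorem varENorm_le_of_varModular_le {f : Ω → ℝ} (hf : AEMeasurable f ν) {K : ℝ} (hK : 1 ≤ K)
    (h : varModular p ν f ≤ ENNReal.ofReal K) : varENorm p ν f ≤ ENNReal.ofReal K := by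
  have hK0 : 0 < K := by linarith
  refine varENorm_le hK0 ?_
  have h1 := varModular_mul_le (p := p) hf (inv_nonneg.2 hK0.le) (inv_le_one_of_one_le₀ hK)
  simp only [div_eq_inv_mul]
  refine h1.trans ((mul_le_mul_right h _).trans ?_)
  rw [← ENNReal.ofReal_mul (by positivity), inv_mul_cancel₀ hK0.ne', ENNReal.ofReal_one]

theorem VarExponent.IsBdd.ae_ne_top (hp : p.IsBdd ν) : ∀ᵐ x ∂ν, p x ≠ ∞ := by
  filter_upwards [ENNReal.ae_le_essSup (μ := ν) p] with x hx
  exact (hx.trans_lt hp.2).ne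

theorem varModular_eq_lintegral (hp : ∀ᵐ x ∂ν, p x ≠ ∞) (f : Ω → ℝ) :
    varModular p ν f = ∫⁻ x, ‖f x‖ₑ ^ (p x).toReal ∂ν := by
  unfold varModular
  have h0 : ν {x | p x = ∞} = 0 := by
    rw [ae_iff] at hp
    simpa using hp
  rw [Measure.restrict_eq_zero.2 h0, essSup_measure_zero, setLIntegral_congr (t := Set.univ),
    Measure.restrict_univ]
  · simp
  · rw [Filter.eventuallyEq_univ]
    exact hp

/-- Young's inequality in the form used for the pointwise multiplier `F ^ (a / b - 1)`. -/
theorem enorm_rpow_mul_rpow_le {F u a b : ℝ} (hF : 0 ≤ F) (hb : 1 ≤ b) (hab : b ≤ a) :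
    ‖F ^ (a / b - 1) * u‖ₑ ^ b ≤ ‖F‖ₑ ^ a + ‖u‖ₑ ^ a := by
  have hb0 : 0 < b := by linarith
  have ha0 : 0 < a := by linarith
  have key : |F ^ (a / b - 1) * u| ^ b ≤ |F| ^ a + |u| ^ a := by
    have h1 : 0 ≤ a / b - 1 := by
      rw [sub_nonneg, le_div_iff₀ hb0]
      linarith
    -- Both factors are dominated by powers of the larger of `F` and `|u|`: the product is at most
    -- `m ^ (a / b)`, whose `b`-th power is `m ^ a`.
    set m := max F |u| with hm
    have hm0 : 0 ≤ m := hF.trans (le_max_left _ _)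
    have h2 : |F ^ (a / b - 1) * u| ≤ m ^ (a / b) := by
      rw [abs_mul, abs_of_nonneg (Real.rpow_nonneg hF _)]
      calc F ^ (a / b - 1) * |u| ≤ m ^ (a / b - 1) * m := by
            gcongr
            · exact le_max_left _ _
            · exact le_max_right _ _
        _ = m ^ (a / b) := by
            rcases hm0.eq_or_lt with h | h
            · rw [← h, Real.zero_rpow (div_pos ha0 hb0).ne', mul_zero]
            · rw [Real.rpow_sub_one h.ne', div_mul_cancel₀ _ h.ne']
    calc |F ^ (a / b - 1) * u| ^ b ≤ (m ^ (a / b)) ^ b := by gcongr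
      _ = m ^ a := by rw [← Real.rpow_mul hm0, div_mul_cancel₀ _ hb0.ne']
      _ ≤ |F| ^ a + |u| ^ a := by
          rw [abs_of_nonneg hF]
          rcases max_choice F |u| with h | h <;> rw [hm, h]
          · exact le_add_of_nonneg_right (by positivity)
          · exact le_add_of_nonneg_left (by positivity)
  have e : ∀ (y c : ℝ), 0 ≤ c → ‖y‖ₑ ^ c = ENNReal.ofReal (|y| ^ c) := fun y c hc => by
    rw [Real.enorm_eq_ofReal_abs, ENNReal.ofReal_rpow_of_nonneg (abs_nonneg _) hc]
  rw [e _ _ hb0.le, e _ _ ha0.le, e _ _ ha0.le, ← ENNReal.ofReal_add (by positivity) (by positivity)]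
  exact ENNReal.ofReal_le_ofReal key

theorem varModular_multiplier_le (hp : ∀ᵐ x ∂ν, p x ≠ ∞) (hq : ∀ᵐ x ∂ν, q x ≠ ∞)
    (hqp : ∀ᵐ x ∂ν, q x ≤ p x) {F u : Ω → ℝ} (hF : Measurable F) (hF0 : ∀ x, 0 ≤ F x) :
    varModular q ν (fun x => F x ^ ((p x).toReal / (q x).toReal - 1) * u x) ≤
      varModular p ν F + varModular p ν u := by
  rw [varModular_eq_lintegral hp, varModular_eq_lintegral hp, varModular_eq_lintegral hq,
    ← lintegral_add_left (hF.enorm.pow p.measurable'.ennreal_toReal)]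
  refine lintegral_mono_ae ?_
  filter_upwards [hp, hq, hqp] with x h1 h2 h3
  exact enorm_rpow_mul_rpow_le (hF0 x) (VarExponent.one_le_toReal h2)
    (ENNReal.toReal_mono h1 h3)

/-- The power substitution between the modulars of two exponents. -/
theorem varModular_rpow_div (hp : ∀ᵐ x ∂ν, p x ≠ ∞) (hq : ∀ᵐ x ∂ν, q x ≠ ∞)
    {F : Ω → ℝ} (hF0 : ∀ x, 0 ≤ F x) :
    varModular q ν (fun x => F x ^ ((p x).toReal / (q x).toReal)) = varModular p ν F := by
  rw [varModular_eq_lintegral hp, varModular_eq_lintegral hq]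
  refine lintegral_congr_ae ?_
  filter_upwards [hp, hq] with x h1 h2
  have h3 := VarExponent.one_le_toReal h2
  have h4 := VarExponent.one_le_toReal h1
  rw [Real.enorm_of_nonneg (hF0 x), Real.enorm_of_nonneg (Real.rpow_nonneg (hF0 x) _),
    ENNReal.ofReal_rpow_of_nonneg (Real.rpow_nonneg (hF0 x) _) (by linarith),
    ENNReal.ofReal_rpow_of_nonneg (hF0 x) (by linarith), ← Real.rpow_mul (hF0 x),
    div_mul_cancel₀ _ (by linarith)]

/-- A finite upper bound on the exponent makes the modular react to dilations in a controlled way;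
this is how `p₊ < ∞` enters the argument for the target exponent. -/
theorem varModular_const_mul_le (hp : ∀ᵐ x ∂ν, p x ≠ ∞) {P : ℝ}
    (hP : ∀ᵐ x ∂ν, (p x).toReal ≤ P) {l : ℝ} (hl : 1 ≤ l) (f : Ω → ℝ) :
    varModular p ν (fun x => l * f x) ≤ ENNReal.ofReal (l ^ P) * varModular p ν f := by
  rw [varModular_eq_lintegral hp, varModular_eq_lintegral hp,
    ← lintegral_const_mul' _ _ ENNReal.ofReal_ne_top]
  refine lintegral_mono_ae ?_
  filter_upwards [hp, hP] with x h1 h2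
  rw [enorm_mul, ENNReal.mul_rpow_of_nonneg _ _ ENNReal.toReal_nonneg,
    Real.enorm_of_nonneg (by linarith), ENNReal.ofReal_rpow_of_nonneg (by linarith)
    ENNReal.toReal_nonneg]
  gcongr

end modular

/-! ### Representatives and multiplication operators on variable Lebesgue spaces -/

namespace VarLp

variable {Ω : Type*} [MeasurableSpace Ω] {p q : VarExponent Ω} {ν : Measure Ω}

theorem measurable_coe (f : VarLp p ν) : Measurable (f : Ω → ℝ) :=
  AEEqFun.measurable _

theorem coeFn_add (f g : VarLp p ν) : ((f + g : VarLp p ν) : Ω → ℝ) =ᵐ[ν] fun x => f x + g x :=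
  AEEqFun.coeFn_add f.toAEEqFun g.toAEEqFun

theorem coeFn_smul (a : ℝ) (f : VarLp p ν) :
    ((a • f : VarLp p ν) : Ω → ℝ) =ᵐ[ν] fun x => a * f x :=
  AEEqFun.coeFn_smul a f.toAEEqFun

theorem coeFn_zero : ((0 : VarLp p ν) : Ω → ℝ) =ᵐ[ν] fun _ => 0 :=
  AEEqFun.coeFn_zero

theorem coeFn_sum {ι : Type*} (S : Finset ι) (f : ι → VarLp p ν) :
    ((∑ i ∈ S, f i : VarLp p ν) : Ω → ℝ) =ᵐ[ν] fun x => ∑ i ∈ S, f i x := by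
  classical
  induction S using Finset.induction_on with
  | empty => simpa using coeFn_zero
  | insert i S hi ih =>
    simp only [Finset.sum_insert hi]
    filter_upwards [coeFn_add (f i) (∑ i ∈ S, f i), ih] with x h1 h2
    rw [h1, h2]

theorem coeFn_sum_smul {ι : Type*} (S : Finset ι) (a : ι → ℝ) (f : ι → VarLp p ν) :
    ((∑ i ∈ S, a i • f i : VarLp p ν) : Ω → ℝ) =ᵐ[ν] fun x => ∑ i ∈ S, a i * f i x := by
  filter_upwards [coeFn_sum S fun i => a i • f i,
    (Filter.eventually_all_finset S).2 fun i _ => coeFn_smul (a i) (f i)] with x h1 h2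
  rw [h1]
  exact Finset.sum_congr rfl h2

/-- The class in `L^{p(·)}` of a measurable function of finite Luxemburg norm. -/
def ofFun (f : Ω → ℝ) (hf : AEMeasurable f ν) (h : varENorm p ν f < ∞) : VarLp p ν :=
  ⟨AEEqFun.mk f hf.aestronglyMeasurable, by
    have : varENorm p ν (AEEqFun.mk f hf.aestronglyMeasurable) < ∞ := by
      rwa [varENorm_congr (AEEqFun.coeFn_mk _ _)]
    exact (varENorm_lt_top_iff (AEEqFun.aemeasurable _)).1 this⟩

theorem coeFn_ofFun (f : Ω → ℝ) (hf : AEMeasurable f ν) (h : varENorm p ν f < ∞) :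
    (ofFun f hf h : Ω → ℝ) =ᵐ[ν] f :=
  AEEqFun.coeFn_mk _ _

theorem ext_ae {f g : VarLp p ν} (h : (f : Ω → ℝ) =ᵐ[ν] g) : f = g :=
  Subtype.ext (AEEqFun.ext h)

theorem enorm_eq (f : VarLp p ν) : ‖f‖ₑ = varENorm p ν f := by
  rw [← ofReal_norm, norm_def, ENNReal.ofReal_toReal f.varENorm_lt_top.ne]

/-- Multiplication by a measurable function, as a bounded operator between variable Lebesgue
spaces. -/
theorem exists_mulCLM {h : Ω → ℝ} (hh : Measurable h) (D : ℝ≥0)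
    (hD : ∀ u : Ω → ℝ, Measurable u →
      varENorm q ν (fun x => h x * u x) ≤ D * varENorm p ν u) :
    ∃ M : VarLp p ν →L[ℝ] VarLp q ν, ‖M‖ₑ ≤ D ∧
      ∀ f : VarLp p ν, (M f : Ω → ℝ) =ᵐ[ν] fun x => h x * f x := by
  have hfin : ∀ f : VarLp p ν, varENorm q ν (fun x => h x * f x) < ∞ := fun f =>
    (hD f f.measurable_coe).trans_lt (ENNReal.mul_lt_top ENNReal.coe_lt_top f.varENorm_lt_top)
  have hm : ∀ f : VarLp p ν, AEMeasurable (fun x => h x * f x) ν := fun f =>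
    (hh.mul f.measurable_coe).aemeasurable
  have hco : ∀ f : VarLp p ν, (ofFun _ (hm f) (hfin f) : Ω → ℝ) =ᵐ[ν] fun x => h x * f x :=
    fun f => coeFn_ofFun _ (hm f) (hfin f)
  let L : VarLp p ν →ₗ[ℝ] VarLp q ν :=
    { toFun := fun f => ofFun _ (hm f) (hfin f)
      map_add' := fun f g => ext_ae <| by
        filter_upwards [hco (f + g), hco f, hco g, coeFn_add f g,
          coeFn_add (ofFun _ (hm f) (hfin f)) (ofFun _ (hm g) (hfin g))] with x h1 h2 h3 h4 h5
        rw [h1, h5, h2, h3, h4, mul_add]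
      map_smul' := fun a f => ext_ae <| by
        filter_upwards [hco (a • f), hco f, coeFn_smul a f,
          coeFn_smul a (ofFun _ (hm f) (hfin f))] with x h1 h2 h3 h4
        rw [h1, RingHom.id_apply, h4, h2, h3]
        ring }
  have hL : ∀ f, ‖L f‖ ≤ D * ‖f‖ := fun f => by
    have h1 : ‖L f‖ₑ ≤ D * ‖f‖ₑ := by
      rw [enorm_eq, enorm_eq]
      exact (varENorm_congr (hco f)).trans_le (hD f f.measurable_coe)
    rw [← ofReal_norm, ← ofReal_norm, ← ENNReal.ofReal_coe_nnreal,
      ← ENNReal.ofReal_mul D.coe_nonneg] at h1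
    exact (ENNReal.ofReal_le_ofReal_iff (by positivity)).1 h1
  refine ⟨L.mkContinuous D hL, ?_, hco⟩
  rw [← ofReal_norm, ← ENNReal.ofReal_coe_nnreal]
  exact ENNReal.ofReal_le_ofReal (L.mkContinuous_norm_le D.2 hL)

end VarLp

/-- Multipliers `F ^ (p / q - 1)` with `ρ_p(F) ≤ K` map `L^{p(·)}` to `L^{q(·)}`, for `q ≤ p`. -/
theorem varENorm_multiplier_le {Ω : Type*} [MeasurableSpace Ω] {p q : VarExponent Ω}
    {ν : Measure Ω} (hp : ∀ᵐ x ∂ν, p x ≠ ∞) (hq : ∀ᵐ x ∂ν, q x ≠ ∞)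
    (hqp : ∀ᵐ x ∂ν, q x ≤ p x) {F u : Ω → ℝ} (hF : Measurable F) (hF0 : ∀ x, 0 ≤ F x)
    (hu : Measurable u) {K : ℝ≥0} (hK : varModular p ν F ≤ K) :
    varENorm q ν (fun x => F x ^ ((p x).toReal / (q x).toReal - 1) * u x) ≤
      (K + 1 : ℝ≥0) * varENorm p ν u := by
  set h : Ω → ℝ := fun x => F x ^ ((p x).toReal / (q x).toReal - 1) with hh
  have hmeas : Measurable h := hF.pow
    ((p.measurable'.ennreal_toReal.div q.measurable'.ennreal_toReal).sub_const 1)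
  rw [mul_comm]
  by_cases hfin : varENorm p ν u = ∞
  · rw [hfin, ENNReal.top_mul (by simp)]
    exact le_top
  refine ENNReal.le_of_forall_pos_le_add fun e he _ => ?_
  have he' : (e / (K + 1 : ℝ≥0) : ℝ≥0) ≠ 0 := by positivity
  obtain ⟨c, hc, h1, h2⟩ := exists_of_varENorm_lt
    (ENNReal.lt_add_right hfin (ENNReal.coe_ne_zero.2 he'))
  -- After normalising `u`, the two modulars contribute at most `K` and `1`; this is the origin of
  -- `K + 1`.
  have h3 : varModular q ν (fun x => h x * (u x / c)) ≤ ENNReal.ofReal (K + 1 : ℝ≥0) := by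
    refine (varModular_multiplier_le hp hq hqp hF hF0).trans ?_
    rw [ENNReal.ofReal_coe_nnreal]
    push_cast
    gcongr
  have h4 := varENorm_le_of_varModular_le ((hmeas.mul (hu.div_const c)).aemeasurable)
    (by simp) h3
  have h5 : (fun x => h x * u x) = fun x => c * (h x * (u x / c)) := by
    funext x
    field_simp
  rw [h5, varENorm_const_mul, Real.enorm_of_nonneg hc.le]
  rw [ENNReal.ofReal_coe_nnreal] at h4
  refine (mul_le_mul' h2.le h4).trans (le_of_eq ?_)
  rw [add_mul, ← ENNReal.coe_mul, div_mul_cancel₀ _ (by positivity)]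

/-! ### The finite-dimensional `ℓ^r`-norm -/

section lrNorm

variable {ι : Type*} [Fintype ι] {r : ℝ}

/-- The `ℓ^r`-norm of a finite family of reals. -/
noncomputable def lrNorm (r : ℝ) (a : ι → ℝ) : ℝ := (∑ k, |a k| ^ r) ^ (1 / r)

theorem sum_abs_rpow_nonneg (r : ℝ) (a : ι → ℝ) : 0 ≤ ∑ k, |a k| ^ r :=
  Finset.sum_nonneg fun _ _ => Real.rpow_nonneg (abs_nonneg _) _

theorem lrNorm_nonneg (a : ι → ℝ) : 0 ≤ lrNorm r a :=
  Real.rpow_nonneg (sum_abs_rpow_nonneg r a) _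

theorem lrNorm_rpow (hr : 0 < r) (a : ι → ℝ) : lrNorm r a ^ r = ∑ k, |a k| ^ r := by
  rw [lrNorm, ← Real.rpow_mul (sum_abs_rpow_nonneg r a), one_div_mul_cancel hr.ne', Real.rpow_one]

theorem lrNorm_smul (hr : 0 < r) (c : ℝ) (a : ι → ℝ) :
    lrNorm r (fun k => c * a k) = |c| * lrNorm r a := by
  unfold lrNorm
  simp only [abs_mul, Real.mul_rpow (abs_nonneg _) (abs_nonneg _)]
  rw [← Finset.mul_sum, Real.mul_rpow (by positivity) (sum_abs_rpow_nonneg r a),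
    ← Real.rpow_mul (abs_nonneg _), mul_one_div_cancel hr.ne', Real.rpow_one]

theorem lrNorm_add_le (hr : 1 ≤ r) (a b : ι → ℝ) :
    lrNorm r (fun k => a k + b k) ≤ lrNorm r a + lrNorm r b :=
  Real.Lp_add_le Finset.univ a b hr

theorem abs_le_lrNorm (hr : 0 < r) (a : ι → ℝ) (k : ι) : |a k| ≤ lrNorm r a := by
  rw [lrNorm, one_div, Real.le_rpow_inv_iff_of_pos (abs_nonneg _) (sum_abs_rpow_nonneg r a) hr]
  exact Finset.single_le_sum (f := fun k => |a k| ^ r)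
    (fun _ _ => Real.rpow_nonneg (abs_nonneg _) _) (Finset.mem_univ k)

/-- Write `y ^ r = y * y ^ (r - 1)` and bound each `|a k| ^ (r - 1)` by the same power of the full
sum. -/
theorem lrNorm_le_sum (hr : 1 ≤ r) (a : ι → ℝ) : lrNorm r a ≤ ∑ k, |a k| := by
  have h0 : 0 ≤ ∑ k, |a k| := Finset.sum_nonneg fun _ _ => abs_nonneg _
  have e : ∀ y : ℝ, 0 ≤ y → y ^ r = y * y ^ (r - 1) := fun y hy => by
    rcases hy.eq_or_lt with h | h
    · rw [← h, Real.zero_rpow (by linarith), zero_mul]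
    · rw [Real.rpow_sub_one h.ne', mul_div_cancel₀ _ h.ne']
  rw [lrNorm, one_div, Real.rpow_inv_le_iff_of_pos (sum_abs_rpow_nonneg r a) h0 (by linarith),
    e _ h0, Finset.sum_mul]
  refine Finset.sum_le_sum fun k _ => ?_
  rw [e _ (abs_nonneg _)]
  gcongr
  exact Finset.single_le_sum (f := fun k => |a k|) (fun _ _ => abs_nonneg _) (Finset.mem_univ k)

end lrNorm

/-! ### Pointwise `ℓ^r`-norms of families of functions -/

section ellr

variable {Ω : Type*} [MeasurableSpace Ω] {p : VarExponent Ω} {ν : Measure Ω} {N : ℕ} {r : ℝ}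

theorem ellrFun_apply {Ω : Type*} (f : Fin N → Ω → ℝ) (x : Ω) :
    ellrFun r f x = lrNorm r fun k => f k x := rfl

theorem ellrFun_nonneg {Ω : Type*} (f : Fin N → Ω → ℝ) (x : Ω) : 0 ≤ ellrFun r f x :=
  lrNorm_nonneg _

theorem measurable_ellrFun {f : Fin N → Ω → ℝ} (hf : ∀ k, Measurable (f k)) :
    Measurable (ellrFun r f) :=
  (Finset.measurable_sum _ fun k _ => (hf k).abs.pow_const r).pow_const _

theorem ellrFun_mul {Ω : Type*} (hr : 0 < r) (h : Ω → ℝ) (f : Fin N → Ω → ℝ) (x : Ω) :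
    ellrFun r (fun k x => h x * f k x) x = |h x| * ellrFun r f x :=
  lrNorm_smul hr _ _

theorem varENorm_ellrFun_lt_top (hr : 1 ≤ r) (f : Fin N → VarLp p ν) :
    varENorm p ν (ellrFun r fun k => f k) < ∞ := by
  refine (varENorm_mono (g := fun x => ∑ k, |f k x|) (Filter.Eventually.of_forall fun x => ?_)).trans_lt
    ((varENorm_sum_le _ fun k _ => ((f k).measurable_coe.abs).aemeasurable).trans_lt ?_)
  · rw [abs_of_nonneg (ellrFun_nonneg _ _)]
    exact (lrNorm_le_sum hr _).trans (le_abs_self _)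
  · simp only [varENorm_abs]
    exact ENNReal.sum_lt_top.2 fun k _ => (f k).varENorm_lt_top

theorem ellrFun_congr {f g : Fin N → Ω → ℝ} (h : ∀ k, f k =ᵐ[ν] g k) :
    ellrFun r f =ᵐ[ν] ellrFun r g := by
  filter_upwards [ae_all_iff.2 h] with x hx
  simp only [ellrFun, hx]

end ellr

/-! ### Change of the target and source exponents -/

section mz

variable {Ω₁ Ω₂ : Type*} [MeasurableSpace Ω₁] [MeasurableSpace Ω₂] {ν : Measure Ω₁}
  {μ : Measure Ω₂}

/-- Passes from individual constants to infima; `1 ≤ K` keeps `K * C` among the admissible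
constants. -/
theorem mzConst_le_mul {q q' : VarExponent Ω₂} {p p' : VarExponent Ω₁} {r r' : ℝ} {K : ℝ≥0}
    (hK : 1 ≤ K) (h : ∀ C, IsMZBound μ ν q p r C → IsMZBound μ ν q' p' r' (K * C)) :
    mzConst μ ν q' p' r' ≤ K * mzConst μ ν q p r := by
  have hK0 : (K : ℝ≥0∞) ≠ 0 := by
    have : K ≠ 0 := (one_pos.trans_le hK).ne'
    exact_mod_cast this
  rw [mul_comm, ← ENNReal.div_le_iff_le_mul (Or.inl hK0) (Or.inl ENNReal.coe_ne_top)]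
  refine le_iInf fun C => le_iInf fun hC => le_iInf fun hb => ?_
  rw [ENNReal.div_le_iff_le_mul (Or.inl hK0) (Or.inl ENNReal.coe_ne_top), mul_comm,
    ← ENNReal.coe_mul]
  exact iInf_le_of_le (K * C) (iInf_le_of_le (one_le_mul hK hC) (iInf_le _ (h C hb)))

/-- Enlarging the target exponent. -/
theorem IsMZBound.of_target_le {q : VarExponent Ω₂} {p₁ p₂ : VarExponent Ω₁} {r : ℝ}
    (hr : 1 ≤ r) (hp₁ : p₁.IsBdd ν) (hp₂ : p₂.IsBdd ν) (h21 : ∀ᵐ x ∂ν, p₂ x ≤ p₁ x)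
    {C : ℝ≥0} (hC : IsMZBound μ ν q p₂ r C) : IsMZBound μ ν q p₁ r (3 * C) := by
  intro T N f
  set F := ellrFun r fun k => T (f k) with hF
  have hFm : Measurable F := measurable_ellrFun fun k => (T (f k)).measurable_coe
  have hF0 : ∀ x, 0 ≤ F x := ellrFun_nonneg _
  have hfin : varENorm p₁ ν F < ∞ := varENorm_ellrFun_lt_top hr _
  set m := (varENorm p₁ ν F).toReal with hm
  have hmE : ENNReal.ofReal m = varENorm p₁ ν F := ENNReal.ofReal_toReal hfin.ne
  -- Adding 1 keeps `P` positive even for the zero measure, where the essential supremum is 0.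
  set P := (essSup p₁ ν).toReal + 1 with hP
  have hP0 : 0 < P := by positivity
  have hPae : ∀ᵐ x ∂ν, (p₁ x).toReal ≤ P := by
    filter_upwards [ENNReal.ae_le_essSup (μ := ν) p₁] with x hx
    have := ENNReal.toReal_mono hp₁.2.ne hx
    linarith
  -- A dilation by `l` at most doubles the modular.
  set l : ℝ := 2 ^ (1 / P) with hl
  have hl1 : 1 < l := Real.one_lt_rpow (by norm_num) (by positivity)
  have hlP : l ^ P = 2 := by
    rw [hl, ← Real.rpow_mul (by norm_num), one_div_mul_cancel hP0.ne', Real.rpow_one]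
  -- For `c` slightly below the norm `m`, the modular of `F / c` lies in `(1, 2]`: it exceeds 1
  -- since `c < m`, and `m < l * c` bounds it by `l ^ P = 2`. Letting `c` increase to `m` gives the
  -- claim.
  suffices key : ∀ c : ℝ, 0 < c → c < m → m < l * c →
      ENNReal.ofReal c ≤ (3 * C : ℝ≥0) * ‖T‖ₑ * varENorm q μ (ellrFun r fun k => f k) by
    rw [← hmE]
    rcases (ENNReal.toReal_nonneg (a := varENorm p₁ ν F)).eq_or_lt with h0 | h0
    · rw [hm, ← h0]
      simp
    · refine le_of_forall_lt fun b hb => ?_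
      have hb' : b.toReal < m := (ENNReal.lt_ofReal_iff_toReal_lt hb.ne_top).1 hb
      obtain ⟨c, hc1, hc2⟩ := exists_between (max_lt hb' (div_lt_self h0 hl1))
      have hc0 : 0 < c := lt_of_le_of_lt (by positivity) ((le_max_right _ _).trans_lt hc1)
      refine lt_of_lt_of_le ?_ (key c hc0 hc2 ?_)
      · rw [ENNReal.lt_ofReal_iff_toReal_lt hb.ne_top]
        exact (le_max_left _ _).trans_lt hc1
      · have := (le_max_right _ _).trans_lt hc1
        rwa [div_lt_iff₀ (by positivity), mul_comm] at this
  intro c hc hcm hml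
  have hFc0 : ∀ x, 0 ≤ F x / c := fun x => div_nonneg (hF0 x) hc.le
  have hlow : 1 < varModular p₁ ν (fun x => F x / c) := by
    by_contra h
    have := varENorm_le hc (not_lt.1 h)
    rw [← hmE] at this
    exact absurd ((ENNReal.ofReal_le_ofReal_iff hc.le).1 this) (not_le.2 hcm)
  have hup : varModular p₁ ν (fun x => F x / c) ≤ (2 : ℝ≥0) := by
    have h1 : varModular p₁ ν (fun x => F x / (l * c)) ≤ 1 := by
      refine varModular_div_le_one ?_
      rw [← hmE]
      exact (ENNReal.ofReal_lt_ofReal_iff (by positivity)).2 hml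
    have h2 := varModular_const_mul_le hp₁.ae_ne_top hPae hl1.le fun x => F x / (l * c)
    have h3 : (fun x => l * (F x / (l * c))) = fun x => F x / c := by
      funext x
      field_simp
    rw [h3, hlP] at h2
    refine h2.trans ((mul_le_mul_right h1 _).trans ?_)
    simp
  set h : Ω₁ → ℝ := fun x => (F x / c) ^ ((p₁ x).toReal / (p₂ x).toReal - 1) with hh
  have hhm : Measurable h := (hFm.div_const c).pow
    ((p₁.measurable'.ennreal_toReal.div p₂.measurable'.ennreal_toReal).sub_const 1)
  have hh0 : ∀ x, 0 ≤ h x := fun x => Real.rpow_nonneg (hFc0 x) _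
  obtain ⟨M, hM, hMf⟩ := VarLp.exists_mulCLM (p := p₁) (q := p₂) hhm (2 + 1) fun u hu =>
    varENorm_multiplier_le hp₁.ae_ne_top hp₂.ae_ne_top h21 (hFm.div_const c) hFc0 hu hup
  -- Almost everywhere `h * (F / c) = (F / c) ^ (p₁ / p₂)`, whose `p₂`-modular is the `p₁`-modular
  -- of `F / c`, hence larger than 1.
  have h1 : 1 ≤ varENorm p₂ ν (fun x => h x * (F x / c)) := by
    by_contra hlt
    have h2 := varModular_div_le_one (c := 1) (by simpa using not_le.1 hlt)
    rw [varModular_congr (g := fun x => (F x / c) ^ ((p₁ x).toReal / (p₂ x).toReal)),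
      varModular_rpow_div hp₁.ae_ne_top hp₂.ae_ne_top hFc0] at h2
    · exact absurd h2 (not_le.2 hlow)
    · filter_upwards [hp₁.ae_ne_top, hp₂.ae_ne_top] with x hx1 hx2
      have e1 := VarExponent.one_le_toReal hx1
      have e2 := VarExponent.one_le_toReal hx2
      rw [div_one, hh]
      dsimp only
      rcases (hFc0 x).eq_or_lt with h0 | h0
      · rw [← h0, mul_zero, Real.zero_rpow (by positivity)]
      · rw [Real.rpow_sub_one h0.ne', div_mul_cancel₀ _ h0.ne']
  have h2 : (fun x => h x * (F x / c)) = fun x => c⁻¹ * (h x * F x) := by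
    funext x
    ring
  rw [h2, varENorm_const_mul, Real.enorm_of_nonneg (by positivity)] at h1
  have h3 : ENNReal.ofReal c ≤ varENorm p₂ ν (fun x => h x * F x) := by
    calc ENNReal.ofReal c ≤ ENNReal.ofReal c * (ENNReal.ofReal c⁻¹ *
          varENorm p₂ ν fun x => h x * F x) := le_mul_of_one_le_right' h1
      _ = _ := by
        rw [← mul_assoc, ← ENNReal.ofReal_mul hc.le, mul_inv_cancel₀ hc.ne', ENNReal.ofReal_one,
          one_mul]
  have h4 : varENorm p₂ ν (fun x => h x * F x) =
      varENorm p₂ ν (ellrFun r fun k => (M ∘L T) (f k)) := by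
    refine varENorm_congr ?_
    have e : ellrFun r (fun k => ((M ∘L T) (f k) : Ω₁ → ℝ)) =ᵐ[ν]
        ellrFun r fun k x => h x * T (f k) x := ellrFun_congr fun k => hMf (T (f k))
    filter_upwards [e] with x hx
    rw [hx, ellrFun_mul (by linarith), abs_of_nonneg (hh0 x)]
  rw [h4] at h3
  refine h3.trans ((hC (M ∘L T) N f).trans (mul_le_mul_left ?_ _))
  have h5 : ‖M ∘L T‖ₑ ≤ ‖M‖ₑ * ‖T‖ₑ := by
    rw [← ofReal_norm, ← ofReal_norm, ← ofReal_norm, ← ENNReal.ofReal_mul (norm_nonneg _)]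
    exact ENNReal.ofReal_le_ofReal (M.opNorm_comp_le T)
  calc (C : ℝ≥0∞) * ‖M ∘L T‖ₑ ≤ C * (((2 + 1 : ℝ≥0) : ℝ≥0∞) * ‖T‖ₑ) := by
        gcongr
        exact h5.trans (by gcongr)
    _ = ((3 * C : ℝ≥0) : ℝ≥0∞) * ‖T‖ₑ := by
        rw [← mul_assoc, ← ENNReal.coe_mul, mul_comm C]
        norm_num

/-- Lowering the source exponent. -/
theorem IsMZBound.of_source_le {q₁ q₂ : VarExponent Ω₂} {p : VarExponent Ω₁} {r : ℝ}
    (hr : 1 ≤ r) (hq₁ : q₁.IsBdd μ) (hq₂ : q₂.IsBdd μ) (h12 : ∀ᵐ x ∂μ, q₁ x ≤ q₂ x)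
    {C : ℝ≥0} (hC : IsMZBound μ ν q₂ p r C) : IsMZBound μ ν q₁ p r (2 * C) := by
  intro T N f
  have hr0 : 0 < r := by linarith
  set F := ellrFun r fun k => f k with hF
  have hFm : Measurable F := measurable_ellrFun fun k => (f k).measurable_coe
  have hF0 : ∀ x, 0 ≤ F x := ellrFun_nonneg _
  have hfin : varENorm q₁ μ F < ∞ := varENorm_ellrFun_lt_top hr _
  suffices key : ∀ c : ℝ, 0 < c → varModular q₁ μ (fun x => F x / c) ≤ 1 →
      varENorm p ν (ellrFun r fun k => T (f k)) ≤ (2 * C : ℝ≥0) * ‖T‖ₑ * ENNReal.ofReal c by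
    have hne : ((2 * C : ℝ≥0) : ℝ≥0∞) * ‖T‖ₑ ≠ ∞ := ENNReal.mul_ne_top ENNReal.coe_ne_top
      enorm_ne_top
    -- A zero factor cannot be divided out of the infimum over `c`; in that case one admissible `c`
    -- suffices.
    by_cases h0 : ((2 * C : ℝ≥0) : ℝ≥0∞) * ‖T‖ₑ = 0
    · obtain ⟨c, hc, h1, -⟩ := exists_of_varENorm_lt hfin
      have := key c hc h1
      rw [h0] at this ⊢
      simpa using this
    · rw [mul_comm, ← ENNReal.div_le_iff_le_mul (Or.inl h0) (Or.inl hne)]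
      refine le_iInf fun c => le_iInf fun hc => le_iInf fun h1 => ?_
      rw [ENNReal.div_le_iff_le_mul (Or.inl h0) (Or.inl hne), mul_comm]
      exact key c hc h1
  intro c hc hmod
  have hFc0 : ∀ x, 0 ≤ F x / c := fun x => div_nonneg (hF0 x) hc.le
  -- `A` is the `q₂`-counterpart of `F / c`, with the same modular. The multiplier `h` built from it
  -- satisfies `h * A = F / c`, so `fₖ / h` has pointwise `ℓ^r`-norm at most `c * A`, which lies in
  -- `L^{q₂}`.
  set A : Ω₂ → ℝ := fun x => (F x / c) ^ ((q₁ x).toReal / (q₂ x).toReal) with hA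
  have hAm : Measurable A := (hFm.div_const c).pow
    (q₁.measurable'.ennreal_toReal.div q₂.measurable'.ennreal_toReal)
  have hA0 : ∀ x, 0 ≤ A x := fun x => Real.rpow_nonneg (hFc0 x) _
  have hAmod : varModular q₂ μ A ≤ (1 : ℝ≥0) := by
    rw [hA, varModular_rpow_div hq₁.ae_ne_top hq₂.ae_ne_top hFc0]
    simpa using hmod
  have hAnorm : varENorm q₂ μ A ≤ 1 := by
    simpa using varENorm_le (p := q₂) (ν := μ) (f := A) one_pos (by simpa using hAmod)
  set h : Ω₂ → ℝ := fun x => A x ^ ((q₂ x).toReal / (q₁ x).toReal - 1) with hh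
  have hhm : Measurable h := hAm.pow
    ((q₂.measurable'.ennreal_toReal.div q₁.measurable'.ennreal_toReal).sub_const 1)
  have hh0 : ∀ x, 0 ≤ h x := fun x => Real.rpow_nonneg (hA0 x) _
  obtain ⟨M, hM, hMf⟩ := VarLp.exists_mulCLM (p := q₂) (q := q₁) hhm (1 + 1) fun u hu =>
    varENorm_multiplier_le hq₂.ae_ne_top hq₁.ae_ne_top h12 hAm hA0 hu hAmod
  have hAh : ∀ᵐ x ∂μ, h x * A x = F x / c := by
    filter_upwards [hq₁.ae_ne_top, hq₂.ae_ne_top] with x hx1 hx2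
    have e1 := VarExponent.one_le_toReal hx1
    have e2 := VarExponent.one_le_toReal hx2
    have e3 : A x ^ ((q₂ x).toReal / (q₁ x).toReal) = F x / c := by
      rw [hA]
      dsimp only
      rw [← Real.rpow_mul (hFc0 x), div_mul_div_cancel₀ (by positivity), div_self (by positivity),
        Real.rpow_one]
    rw [← e3, hh]
    dsimp only
    rcases (hA0 x).eq_or_lt with h0 | h0
    · rw [← h0, mul_zero, Real.zero_rpow (by positivity)]
    · rw [Real.rpow_sub_one h0.ne', div_mul_cancel₀ _ h0.ne']
  have hgF : ∀ᵐ x ∂μ, |(h x)⁻¹ * F x| ≤ |c * A x| := by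
    filter_upwards [hAh] with x hx
    have e : F x = c * (h x * A x) := by
      rw [hx]
      field_simp
    rw [e]
    rcases (hh0 x).eq_or_lt with h0 | h0
    · rw [← h0, inv_zero, zero_mul, abs_zero]
      exact abs_nonneg _
    · rw [mul_left_comm c, inv_mul_cancel_left₀ h0.ne']
  have hgnorm : varENorm q₂ μ (fun x => (h x)⁻¹ * F x) ≤ ENNReal.ofReal c := by
    refine (varENorm_mono hgF).trans ?_
    rw [varENorm_const_mul, Real.enorm_of_nonneg hc.le]
    exact mul_le_of_le_one_right' hAnorm
  have hgk : ∀ k, varENorm q₂ μ (fun x => (h x)⁻¹ * f k x) < ∞ := fun k => by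
    refine (varENorm_mono (Filter.Eventually.of_forall fun x => ?_)).trans_lt
      (hgnorm.trans_lt ENNReal.ofReal_lt_top)
    rw [abs_mul, abs_mul, abs_of_nonneg (hF0 x)]
    gcongr
    exact abs_le_lrNorm hr0 (fun k => f k x) k
  let g : Fin N → VarLp q₂ μ := fun k => VarLp.ofFun _
    (hhm.inv.mul (f k).measurable_coe).aemeasurable (hgk k)
  have hg : ∀ k, (g k : Ω₂ → ℝ) =ᵐ[μ] fun x => (h x)⁻¹ * f k x := fun k =>
    VarLp.coeFn_ofFun _ _ _
  have hMg : ∀ k, M (g k) = f k := fun k => VarLp.ext_ae <| by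
    filter_upwards [hMf (g k), hg k, hAh] with x h1 h2 h3
    rw [h1, h2]
    -- Where `h` vanishes, so does `F`, hence every `f k`; the default value `0⁻¹ = 0` is therefore
    -- harmless.
    rcases (hh0 x).eq_or_lt with h0 | h0
    · have h4 : F x = 0 := by
        rw [← h0, zero_mul, eq_comm, div_eq_zero_iff] at h3
        exact h3.resolve_right hc.ne'
      have h5 := abs_le_lrNorm hr0 (fun k => f k x) k
      rw [← ellrFun_apply (fun k => (f k : Ω₂ → ℝ)), ← hF, h4] at h5
      rw [← h0, zero_mul, abs_eq_zero.1 (le_antisymm h5 (abs_nonneg _))]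
    · rw [mul_inv_cancel_left₀ h0.ne']
  have hmain := hC (T ∘L M) N g
  have e1 : (fun k => ((T ∘L M) (g k) : Ω₁ → ℝ)) = fun k => (T (f k) : Ω₁ → ℝ) := by
    funext k
    rw [ContinuousLinearMap.comp_apply, hMg]
  have e2 : varENorm q₂ μ (ellrFun r fun k => g k) = varENorm q₂ μ (fun x => (h x)⁻¹ * F x) := by
    refine varENorm_congr ((ellrFun_congr hg).trans (Filter.Eventually.of_forall fun x => ?_))
    rw [ellrFun_mul hr0, abs_of_nonneg (inv_nonneg.2 (hh0 x))]
  rw [e1, e2] at hmain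
  refine hmain.trans ?_
  have h5 : ‖T ∘L M‖ₑ ≤ ‖T‖ₑ * ‖M‖ₑ := by
    rw [← ofReal_norm, ← ofReal_norm, ← ofReal_norm, ← ENNReal.ofReal_mul (norm_nonneg _)]
    exact ENNReal.ofReal_le_ofReal (T.opNorm_comp_le M)
  calc (C : ℝ≥0∞) * ‖T ∘L M‖ₑ * varENorm q₂ μ (fun x => (h x)⁻¹ * F x)
      ≤ C * (‖T‖ₑ * ((1 + 1 : ℝ≥0) : ℝ≥0∞)) * ENNReal.ofReal c := by
        gcongr
        exact h5.trans (by gcongr)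
    _ = _ := by
        push_cast
        ring

end mz

/-! ### The integral of `(1 - cos (y t)) t^{-1-r}` over the half-line -/

section kernel

open Set Filter Topology

/-- Near 0 the integrand is `O(t^{s-1-r})` with `s > r`, and at infinity `O(t^{-1-r})` with `r > 0`.
It serves as the dominating function below. -/
theorem integrableOn_min_two_mul_rpow {r s : ℝ} (hr : 0 < r) (hrs : r < s) (D : ℝ) :
    IntegrableOn (fun t : ℝ => min 2 (|D| * t ^ s) * t ^ (-1 - r)) (Ioi 0) := by
  have hm : Measurable (fun t : ℝ => min 2 (|D| * t ^ s) * t ^ (-1 - r)) :=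
    (measurable_const.min ((measurable_id.pow_const s).const_mul _)).mul
      (measurable_id.pow_const _)
  rw [← Ioc_union_Ioi_eq_Ioi (zero_le_one (α := ℝ)), integrableOn_union]
  constructor
  · have h1 : IntegrableOn (fun t : ℝ => |D| * t ^ (s - 1 - r)) (Ioc 0 1) := by
      refine Integrable.const_mul ?_ _
      have := intervalIntegral.intervalIntegrable_rpow' (a := 0) (b := 1) (r := s - 1 - r)
        (by linarith)
      rwa [intervalIntegrable_iff_integrableOn_Ioc_of_le zero_le_one] at this
    refine h1.mono' hm.aestronglyMeasurable ?_
    filter_upwards [ae_restrict_mem measurableSet_Ioc] with t ht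
    have ht0 : 0 < t := ht.1
    rw [Real.norm_of_nonneg (by positivity)]
    calc min 2 (|D| * t ^ s) * t ^ (-1 - r) ≤ |D| * t ^ s * t ^ (-1 - r) := by
          gcongr
          exact min_le_right _ _
      _ = |D| * t ^ (s - 1 - r) := by
          rw [mul_assoc, ← Real.rpow_add ht0]
          ring_nf
  · have h1 : IntegrableOn (fun t : ℝ => 2 * t ^ (-1 - r)) (Ioi 1) :=
      (integrableOn_Ioi_rpow_of_lt (by linarith) one_pos).const_mul _
    refine h1.mono' hm.aestronglyMeasurable ?_
    filter_upwards [ae_restrict_mem measurableSet_Ioi] with t ht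
    have ht0 : 0 < t := one_pos.trans ht
    rw [Real.norm_of_nonneg (by positivity)]
    gcongr
    exact min_le_left _ _

theorem integrableOn_mul_rpow_of_le {r s : ℝ} (hr : 0 < r) (hrs : r < s) {D : ℝ} {F : ℝ → ℝ}
    (hF : Measurable F) (hF0 : ∀ t, 0 < t → 0 ≤ F t) (hF2 : ∀ t, 0 < t → F t ≤ 2)
    (hFD : ∀ t, 0 < t → F t ≤ |D| * t ^ s) :
    IntegrableOn (fun t : ℝ => F t * t ^ (-1 - r)) (Ioi 0) := by
  refine (integrableOn_min_two_mul_rpow hr hrs D).mono'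
    (hF.mul (measurable_id.pow_const _)).aestronglyMeasurable ?_
  filter_upwards [ae_restrict_mem measurableSet_Ioi] with t ht
  have ht0 : 0 < t := ht
  rw [Real.norm_of_nonneg (mul_nonneg (hF0 t ht0) (by positivity))]
  gcongr
  exact le_min (hF2 t ht0) (hFD t ht0)

theorem setIntegral_mul_rpow_comp_mul (F : ℝ → ℝ) (r : ℝ) {b : ℝ} (hb : 0 < b) :
    ∫ t in Ioi (0 : ℝ), F (b * t) * t ^ (-1 - r) =
      b ^ r * ∫ t in Ioi (0 : ℝ), F t * t ^ (-1 - r) := by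
  have h := integral_comp_mul_left_Ioi (fun u => F u * u ^ (-1 - r)) 0 hb
  rw [mul_zero] at h
  have h2 : ∫ t in Ioi (0 : ℝ), F (b * t) * t ^ (-1 - r) =
      b ^ (1 + r) * ∫ t in Ioi (0 : ℝ), F (b * t) * (b * t) ^ (-1 - r) := by
    rw [← integral_const_mul]
    refine setIntegral_congr_fun measurableSet_Ioi fun t ht => ?_
    have ht0 : 0 < t := ht
    rw [Real.mul_rpow hb.le ht0.le, mul_left_comm, ← mul_assoc (b ^ (1 + r)), ← Real.rpow_add hb]
    ring_nf
    simp
  rw [h2, h, smul_eq_mul, ← mul_assoc, Real.rpow_add hb, Real.rpow_one, mul_comm b, mul_assoc (b ^ r),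
    mul_inv_cancel₀ hb.ne', mul_one]

theorem setIntegral_mul_rpow_pos {F : ℝ → ℝ} {r : ℝ}
    (hint : IntegrableOn (fun t : ℝ => F t * t ^ (-1 - r)) (Ioi 0))
    (hF0 : ∀ t, 0 < t → 0 ≤ F t) (hF : ∀ t ∈ Ioo (0 : ℝ) 1, 0 < F t) :
    0 < ∫ t in Ioi (0 : ℝ), F t * t ^ (-1 - r) := by
  rw [setIntegral_pos_iff_support_of_nonneg_ae _ hint]
  · refine lt_of_lt_of_le ?_ (measure_mono (s := Ioo (0 : ℝ) 1) fun t ht => ⟨?_, ht.1⟩)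
    · simp
    · exact (mul_pos (hF t ht) (Real.rpow_pos_of_pos ht.1 _)).ne'
  · filter_upwards [ae_restrict_mem measurableSet_Ioi] with t ht
    exact mul_nonneg (hF0 t ht) (Real.rpow_nonneg (le_of_lt ht) _)

theorem one_sub_cos_nonneg (t : ℝ) : 0 ≤ 1 - Real.cos t := sub_nonneg.2 (Real.cos_le_one t)

theorem one_sub_cos_le_two (t : ℝ) : 1 - Real.cos t ≤ 2 := by
  linarith [Real.neg_one_le_cos t]

theorem one_sub_cos_le_sq (t : ℝ) : 1 - Real.cos t ≤ 1 / 2 * t ^ 2 := by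
  linarith [Real.one_sub_sq_div_two_le_cos (x := t)]

theorem integrableOn_one_sub_cos {r : ℝ} (hr : 0 < r) (hr2 : r < 2) (y : ℝ) :
    IntegrableOn (fun t : ℝ => (1 - Real.cos (y * t)) * t ^ (-1 - r)) (Ioi 0) := by
  refine integrableOn_mul_rpow_of_le hr hr2 (D := 1 / 2 * y ^ 2) (by fun_prop)
    (fun t _ => one_sub_cos_nonneg _) (fun t _ => one_sub_cos_le_two _) fun t ht => ?_
  rw [abs_of_nonneg (by positivity), Real.rpow_two, mul_assoc, ← mul_pow]
  exact one_sub_cos_le_sq _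

/-- The constant `∫₀^∞ (1 - cos t) t^{-1-r} dt`. -/
noncomputable def cosKernel (r : ℝ) : ℝ := ∫ t in Ioi (0 : ℝ), (1 - Real.cos t) * t ^ (-1 - r)

theorem cosKernel_pos {r : ℝ} (hr : 0 < r) (hr2 : r < 2) : 0 < cosKernel r := by
  refine setIntegral_mul_rpow_pos ?_ (fun t _ => one_sub_cos_nonneg t) fun t ht => ?_
  · simpa using integrableOn_one_sub_cos hr hr2 1
  · rw [sub_pos]
    calc Real.cos t < Real.cos 0 := Real.cos_lt_cos_of_nonneg_of_le_pi le_rfl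
          (ht.2.le.trans (by linarith [Real.pi_gt_three])) ht.1
      _ = 1 := Real.cos_zero

/-- Scaling by `|y|`, together with evenness of the cosine. -/
theorem setIntegral_one_sub_cos_mul {r : ℝ} (hr : 0 < r) (y : ℝ) :
    ∫ t in Ioi (0 : ℝ), (1 - Real.cos (y * t)) * t ^ (-1 - r) = |y| ^ r * cosKernel r := by
  rcases eq_or_ne y 0 with rfl | hy
  · simp [Real.zero_rpow hr.ne']
  · rw [cosKernel, ← setIntegral_mul_rpow_comp_mul (fun u => 1 - Real.cos u) r (abs_pos.2 hy)]
    refine setIntegral_congr_fun measurableSet_Ioi fun t ht => ?_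
    have ht0 : 0 < t := ht
    rw [← Real.cos_abs (y * t), abs_mul, abs_of_pos ht0]

end kernel

/-! ### Laws attracted to symmetric stable laws -/

section law

open Set Filter Topology ProbabilityTheory

/-- Averaging `m` with its reflection cancels the sine part of the characteristic function. -/
theorem exists_symmetric_measure (m : Measure ℝ) [IsProbabilityMeasure m] :
    ∃ m' : Measure ℝ, IsProbabilityMeasure m' ∧
      ∀ t, charFun m' t = ((∫ x, Real.cos (t * x) ∂m : ℝ) : ℂ) := by
  have : IsProbabilityMeasure (m.map fun x => -x) :=
    Measure.isProbabilityMeasure_map measurable_neg.aemeasurable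
  refine ⟨(2⁻¹ : ℝ≥0) • m + (2⁻¹ : ℝ≥0) • m.map fun x => -x, ⟨?_⟩, fun t => ?_⟩
  · simp only [Measure.coe_add, Measure.coe_nnreal_smul_apply, Pi.add_apply, measure_univ, mul_one]
    rw [← ENNReal.coe_add, ← ENNReal.coe_one]
    rw [← two_mul, mul_inv_cancel₀ two_ne_zero]
  · have hint : ∀ (n : Measure ℝ) [IsFiniteMeasure n] (t : ℝ),
        Integrable (fun x : ℝ => Complex.exp (t * x * Complex.I)) n := fun n _ t =>
      (integrable_const (1 : ℝ)).mono' (by fun_prop) (Eventually.of_forall fun x => by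
        rw [← Complex.ofReal_mul, Complex.norm_exp_ofReal_mul_I])
    rw [charFun_apply_real, integral_add_measure (hint _ _) (hint _ _),
      integral_smul_nnreal_measure, integral_smul_nnreal_measure,
      integral_map (by fun_prop) (by fun_prop), ← smul_add, ← integral_add (hint _ _),
      NNReal.smul_def, ← integral_smul, ← integral_complex_ofReal]
    · refine integral_congr_ae (Eventually.of_forall fun x => ?_)
      simp only [Complex.ofReal_neg, mul_neg, neg_mul, Complex.ofReal_cos, Complex.ofReal_mul,
        Complex.cos]
      simp
      ring
    · have := hint m (-t)
      simpa using this

/-- A symmetric law in the domain of attraction of the symmetric `s`-stable law. -/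
theorem exists_law_of_stable_attraction {s : ℝ} (hs : 0 < s) (hs2 : s ≤ 2) :
    ∃ m : Measure ℝ, IsProbabilityMeasure m ∧ ∃ φ κ : ℝ → ℝ, ∃ D : ℝ,
      (∀ t, charFun m t = (φ t : ℂ)) ∧ (∀ t, 1 - φ t = |t| ^ s * κ t) ∧ (∀ t, 0 ≤ κ t) ∧
      (∀ t, κ t ≤ D) ∧ 0 < κ 0 ∧ ContinuousAt κ 0 := by
  rcases hs2.lt_or_eq with hs2 | rfl
  -- For `s < 2` a symmetrised Pareto law works: its tail density is proportional to `|x|^{-1-s}`,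
  -- and the substitution `u = |t| x` in `∫ (1 - cos (t x)) s x^{-1-s} dx` over `x > 1` yields
  -- `|t|^s κ(t)`.
  · have := isProbabilityMeasure_paretoMeasure one_pos hs
    obtain ⟨m, hm, hφ⟩ := exists_symmetric_measure (paretoMeasure 1 s)
    have hint : IntegrableOn (fun u : ℝ => (1 - Real.cos u) * u ^ (-1 - s)) (Ioi 0) := by
      simpa using integrableOn_one_sub_cos hs hs2 1
    have hnn : ∀ u : ℝ, 0 < u → 0 ≤ (1 - Real.cos u) * u ^ (-1 - s) := fun u hu =>
      mul_nonneg (one_sub_cos_nonneg u) (Real.rpow_nonneg hu.le _)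
    refine ⟨m, hm, _, fun t => s * ∫ u in Ioi |t|, (1 - Real.cos u) * u ^ (-1 - s),
      s * cosKernel s, hφ, fun t => ?_, fun t => ?_, fun t => ?_, ?_, ?_⟩
    · have hcos : Integrable (fun x => Real.cos (t * x)) (paretoMeasure 1 s) :=
        (integrable_const (1 : ℝ)).mono' (by fun_prop) (Eventually.of_forall fun x =>
          Real.abs_cos_le_one _)
      have h1 : 1 - ∫ x, Real.cos (t * x) ∂paretoMeasure 1 s =
          ∫ x in Ioi (1 : ℝ), (1 - Real.cos (t * x)) * (s * x ^ (-1 - s)) := by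
        have e1 : (1 : ℝ) = ∫ _, (1 : ℝ) ∂paretoMeasure 1 s := by simp
        nth_rewrite 1 [e1]
        rw [← integral_sub (integrable_const _) hcos, paretoMeasure,
          integral_withDensity_eq_integral_toReal_smul
            (show Measurable (paretoPDF 1 s) from (measurable_paretoPDFReal 1 s).ennreal_ofReal)
            (Eventually.of_forall fun _ => ENNReal.ofReal_lt_top), ← integral_Ici_eq_integral_Ioi,
          ← integral_indicator measurableSet_Ici]
        refine integral_congr_ae (Eventually.of_forall fun x => ?_)
        by_cases hx : 1 ≤ x
        · simp only [paretoPDF_of_le hx, smul_eq_mul, indicator_of_mem (mem_Ici.2 hx)]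
          rw [ENNReal.toReal_ofReal (by positivity), Real.one_rpow, mul_one, mul_comm]
          ring_nf
        · simp [paretoPDF_of_lt (not_le.1 hx), hx]
      rw [h1]
      rcases eq_or_ne t 0 with rfl | ht
      · simp [Real.zero_rpow hs.ne']
      · have ht0 := abs_pos.2 ht
        have h2 := integral_comp_mul_left_Ioi (fun u => (1 - Real.cos u) * u ^ (-1 - s)) 1 ht0
        rw [mul_one, smul_eq_mul] at h2
        have h3 : ∫ x in Ioi (1 : ℝ), (1 - Real.cos (t * x)) * (s * x ^ (-1 - s)) =
            s * |t| ^ (1 + s) *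
              ∫ x in Ioi (1 : ℝ), (1 - Real.cos (|t| * x)) * (|t| * x) ^ (-1 - s) := by
          rw [← integral_const_mul]
          refine setIntegral_congr_fun measurableSet_Ioi fun x hx => ?_
          have hx0 : 0 < x := one_pos.trans hx
          have e : |t| ^ (1 + s) * |t| ^ (-1 - s) = 1 := by
            rw [← Real.rpow_add ht0]
            ring_nf
            simp
          rw [← Real.cos_abs (t * x), abs_mul, abs_of_pos hx0, Real.mul_rpow ht0.le hx0.le]
          linear_combination (-((1 - Real.cos (|t| * x)) * s * x ^ (-1 - s))) * e
        rw [h3, h2, Real.rpow_add ht0, Real.rpow_one]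
        field_simp
    · exact mul_nonneg hs.le (setIntegral_nonneg measurableSet_Ioi fun u hu =>
        hnn u ((abs_nonneg t).trans_lt hu))
    · refine mul_le_mul_of_nonneg_left (setIntegral_mono_set hint ?_ ?_) hs.le
      · filter_upwards [ae_restrict_mem measurableSet_Ioi] with u hu using hnn u hu
      · exact (Ioi_subset_Ioi (abs_nonneg t)).eventuallyLE
    · simpa [cosKernel] using mul_pos hs (cosKernel_pos hs hs2)
    -- The half-lines `u > |t|` exhaust `u > 0` as `t → 0`.
    · refine ContinuousAt.mul continuousAt_const ?_
      have hc : AECover (volume.restrict (Ioi (0 : ℝ))) (𝓝 (0 : ℝ)) fun t : ℝ => Ioi |t| :=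
        aecover_Ioi_of_Ioi (by simpa using (continuous_abs (G := ℝ)).tendsto 0)
      have h := hc.integral_tendsto_of_countably_generated hint
      have e : ∀ t : ℝ, (volume.restrict (Ioi (0 : ℝ))).restrict (Ioi |t|) =
          volume.restrict (Ioi |t|) := fun t => by
        rw [Measure.restrict_restrict measurableSet_Ioi,
          inter_eq_left.2 (Ioi_subset_Ioi (abs_nonneg t))]
      simp only [e] at h
      simpa [ContinuousAt] using h
  -- For `s = 2` a random sign suffices: `1 - cos t = 2 sin² (t / 2) = t² sinc² (t / 2) / 2`.
  · obtain ⟨m, hm, hφ⟩ := exists_symmetric_measure (Measure.dirac (1 : ℝ))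
    refine ⟨m, hm, _, fun t => Real.sinc (t / 2) ^ 2 / 2, 1 / 2, hφ, fun t => ?_,
      fun t => by positivity, fun t => ?_, by simp, by fun_prop⟩
    · rw [integral_dirac, mul_one, Real.rpow_two, sq_abs]
      rcases eq_or_ne t 0 with rfl | ht
      · simp
      · have h := Real.cos_sq_add_sin_sq (t / 2)
        have h2 := Real.cos_two_mul (t / 2)
        rw [mul_div_cancel₀ t two_ne_zero] at h2
        dsimp only
        rw [Real.sinc_of_ne_zero (by positivity), h2]
        field_simp
        linarith
    · have : Real.sinc (t / 2) ^ 2 ≤ 1 := by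
        rw [sq_le_one_iff_abs_le_one]
        exact Real.abs_sinc_le_one _
      linarith

end law

/-! ### Moments and limits of characteristic functions -/

section moments

open Set Filter Topology

/-- Absolute moments of order `r < 2` in terms of the real part of the characteristic function. -/
theorem integral_abs_rpow_of_cos {Ω : Type*} [MeasurableSpace Ω] (P : Measure Ω)
    [IsProbabilityMeasure P] {Y : Ω → ℝ} (hY : Measurable Y) {r : ℝ} (hr : 0 < r) (hr2 : r < 2)
    (hint : IntegrableOn (fun t : ℝ => (1 - ∫ ω, Real.cos (Y ω * t) ∂P) * t ^ (-1 - r)) (Ioi 0)) :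
    Integrable (fun ω => |Y ω| ^ r) P ∧ (∫ ω, |Y ω| ^ r ∂P) * cosKernel r =
      ∫ t in Ioi (0 : ℝ), (1 - ∫ ω, Real.cos (Y ω * t) ∂P) * t ^ (-1 - r) := by
  have hK := cosKernel_pos hr hr2
  have hcos : ∀ t, Integrable (fun ω => Real.cos (Y ω * t)) P := fun t =>
    (integrable_const (1 : ℝ)).mono' (by fun_prop) (Eventually.of_forall fun x =>
      Real.abs_cos_le_one _)
  have hsub : ∀ t, 1 - ∫ ω, Real.cos (Y ω * t) ∂P = ∫ ω, (1 - Real.cos (Y ω * t)) ∂P :=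
    fun t => by
      rw [integral_sub (integrable_const _) (hcos t)]
      simp
  have hnn : 0 ≤ᵐ[volume.restrict (Ioi (0 : ℝ))]
      fun t : ℝ => (1 - ∫ ω, Real.cos (Y ω * t) ∂P) * t ^ (-1 - r) := by
    filter_upwards [ae_restrict_mem measurableSet_Ioi] with t ht
    rw [hsub]
    exact mul_nonneg (integral_nonneg fun ω => one_sub_cos_nonneg _)
      (Real.rpow_nonneg (le_of_lt ht) _)
  -- Tonelli is applied in `ℝ≥0∞`, so that integrability of `|Y| ^ r` comes out together with the
  -- formula.
  have key : ∫⁻ ω, ENNReal.ofReal (|Y ω| ^ r * cosKernel r) ∂P = ENNReal.ofReal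
      (∫ t in Ioi (0 : ℝ), (1 - ∫ ω, Real.cos (Y ω * t) ∂P) * t ^ (-1 - r)) := by
    rw [ofReal_integral_eq_lintegral_ofReal hint hnn]
    calc ∫⁻ ω, ENNReal.ofReal (|Y ω| ^ r * cosKernel r) ∂P
        = ∫⁻ ω, (∫⁻ t in Ioi (0 : ℝ),
            ENNReal.ofReal ((1 - Real.cos (Y ω * t)) * t ^ (-1 - r))) ∂P := by
          refine lintegral_congr fun ω => ?_
          rw [← setIntegral_one_sub_cos_mul hr, ofReal_integral_eq_lintegral_ofReal
            (integrableOn_one_sub_cos hr hr2 _)]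
          filter_upwards [ae_restrict_mem measurableSet_Ioi] with t ht
          exact mul_nonneg (one_sub_cos_nonneg _) (Real.rpow_nonneg (le_of_lt ht) _)
      _ = ∫⁻ t in Ioi (0 : ℝ), (∫⁻ ω,
            ENNReal.ofReal ((1 - Real.cos (Y ω * t)) * t ^ (-1 - r)) ∂P) := by
          refine lintegral_lintegral_swap ?_
          have : Measurable fun z : Ω × ℝ =>
              ENNReal.ofReal ((1 - Real.cos (Y z.1 * z.2)) * z.2 ^ (-1 - r)) := by
            fun_prop
          exact this.aemeasurable
      _ = _ := by
          refine setLIntegral_congr_fun measurableSet_Ioi fun t ht => ?_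
          rw [hsub, ← integral_mul_const, ofReal_integral_eq_lintegral_ofReal]
          · exact (((integrable_const _).sub (hcos t))).mul_const _
          · exact Eventually.of_forall fun ω => mul_nonneg (one_sub_cos_nonneg _)
              (Real.rpow_nonneg (le_of_lt ht) _)
  have hmeas : Measurable fun ω => |Y ω| ^ r := by fun_prop
  have hnn' : ∀ ω, 0 ≤ |Y ω| ^ r * cosKernel r := fun ω => by positivity
  have hi : Integrable (fun ω => |Y ω| ^ r * cosKernel r) P := by
    refine ⟨(hmeas.mul_const _).aestronglyMeasurable, ?_⟩
    rw [hasFiniteIntegral_iff_ofReal (Eventually.of_forall hnn'), key]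
    exact ENNReal.ofReal_lt_top
  refine ⟨?_, ?_⟩
  · have := hi.mul_const (cosKernel r)⁻¹
    simpa [mul_assoc, hK.ne'] using this
  · rw [← integral_mul_const, integral_eq_lintegral_of_nonneg_ae (Eventually.of_forall hnn')
      (hmeas.mul_const _).aestronglyMeasurable, key, ENNReal.toReal_ofReal]
    exact integral_nonneg_of_ae hnn

/-- Independence factors the characteristic function, and each factor is real. -/
theorem integral_cos_sum_pi {ι : Type*} [Fintype ι] (m : Measure ℝ) [IsProbabilityMeasure m]
    {φ : ℝ → ℝ} (hφ : ∀ t, charFun m t = (φ t : ℂ)) (b : ι → ℝ) :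
    ∫ ω : ι → ℝ, Real.cos (∑ i, b i * ω i) ∂(Measure.pi fun _ => m) = ∏ i, φ (b i) := by
  have h1 : ∫ ω : ι → ℝ, Complex.exp (((∑ i, b i * ω i : ℝ) : ℂ) * Complex.I)
      ∂(Measure.pi fun _ => m) = ((∏ i, φ (b i) : ℝ) : ℂ) := by
    have h := integral_fintype_prod_eq_prod (𝕜 := ℂ) (μ := fun _ : ι => m)
      (fun i (x : ℝ) => Complex.exp (b i * x * Complex.I))
    simp only [← charFun_apply_real, hφ] at h
    rw [Complex.ofReal_prod, ← h]
    refine integral_congr_ae (Eventually.of_forall fun ω => ?_)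
    dsimp only
    rw [← Complex.exp_sum]
    push_cast
    rw [Finset.sum_mul]
  have hint : Integrable (fun ω : ι → ℝ =>
      Complex.exp (((∑ i, b i * ω i : ℝ) : ℂ) * Complex.I)) (Measure.pi fun _ => m) :=
    (integrable_const (1 : ℝ)).mono' (Continuous.aestronglyMeasurable (by fun_prop)) (Eventually.of_forall fun x => by
      rw [Complex.norm_exp_ofReal_mul_I])
  have h2 := integral_re hint
  simp only [RCLike.re_to_complex, Complex.exp_ofReal_mul_I_re] at h2
  rw [h2]
  rw [h1, Complex.ofReal_re]

/-- Induction on `1 - x y = (1 - x) + (1 - y) - (1 - x) (1 - y)`, whose last product is nonnegative.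
It supplies a domination that does not depend on the number of summands. -/
theorem one_sub_prod_le_sum {ι : Type*} (S : Finset ι) {x : ι → ℝ} (hx : ∀ i, |x i| ≤ 1) :
    1 - ∏ i ∈ S, x i ≤ ∑ i ∈ S, (1 - x i) := by
  classical
  induction S using Finset.induction_on with
  | empty => simp
  | insert i S hi ih =>
    rw [Finset.prod_insert hi, Finset.sum_insert hi]
    have h1 : |∏ j ∈ S, x j| ≤ 1 := by
      rw [Finset.abs_prod]
      exact Finset.prod_le_one (fun _ _ => abs_nonneg _) fun j _ => hx j
    have h2 := abs_le.1 (hx i)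
    have h3 := abs_le.1 h1
    nlinarith

/-- Eventually `1 - z` and `exp (-z)` have modulus at most 1 and differ by at most `z²`, so their
`n`-th powers differ by at most `n z² = (n z) z → 0`. A general filter allows `n` and the
coefficients to vary jointly. -/
theorem tendsto_one_sub_pow_exp {α : Type*} {l : Filter α} {n : α → ℕ} {z : α → ℝ} {c : ℝ}
    (hn : Tendsto n l atTop) (hz0 : ∀ i, 0 ≤ z i)
    (h : Tendsto (fun i => n i * z i) l (𝓝 c)) :
    Tendsto (fun i => (1 - z i) ^ n i) l (𝓝 (Real.exp (-c))) := by
  have hn' : Tendsto (fun i => (n i : ℝ)) l atTop := tendsto_natCast_atTop_atTop.comp hn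
  have hz : Tendsto z l (𝓝 0) := by
    have h1 := h.mul hn'.inv_tendsto_atTop
    rw [mul_zero] at h1
    refine h1.congr' ?_
    filter_upwards [hn'.eventually_gt_atTop 0] with i hi
    simp only [Pi.inv_apply]
    field_simp
  have hexp : Tendsto (fun i => Real.exp (-(n i * z i))) l (𝓝 (Real.exp (-c))) :=
    (Real.continuous_exp.tendsto _).comp h.neg
  have herr : Tendsto (fun i => (n i * z i) * z i) l (𝓝 0) := by simpa using h.mul hz
  have hdiff : Tendsto (fun i => (1 - z i) ^ n i - Real.exp (-(n i * z i))) l (𝓝 0) := by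
    refine squeeze_zero_norm' ?_ herr
    filter_upwards [hz.eventually_le_const one_pos] with i hi
    have e1 : Real.exp (-(n i * z i)) = Real.exp (-z i) ^ n i := by
      rw [← Real.exp_nat_mul]
      ring_nf
    have h1 : |1 - z i| ≤ 1 := abs_le.2 ⟨by linarith, by linarith [hz0 i]⟩
    have h2 : |Real.exp (-z i)| ≤ 1 := by
      rw [abs_of_pos (Real.exp_pos _), Real.exp_le_one_iff]
      linarith [hz0 i]
    have h3 : |1 - z i - Real.exp (-z i)| ≤ z i ^ 2 := by
      have := Real.abs_exp_sub_one_sub_id_le (x := -z i) (by rwa [abs_neg, abs_of_nonneg (hz0 i)])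
      rw [abs_sub_comm]
      rw [neg_sq] at this
      convert this using 2
      ring
    rw [e1, Real.norm_eq_abs]
    refine (abs_pow_sub_pow_le _ _ _).trans ?_
    calc |1 - z i - Real.exp (-z i)| * n i * max |1 - z i| |Real.exp (-z i)| ^ (n i - 1)
        ≤ z i ^ 2 * n i * 1 := by
          gcongr
          exact pow_le_one₀ (le_max_of_le_left (abs_nonneg _)) (max_le h1 h2)
      _ = _ := by ring
  simpa using hdiff.add hexp

end moments

/-! ### Uniform approximation of the `ℓ^s`-norm by `r`-th moments -/

section stable

open Set Filter Topology

theorem isCompact_sum_abs_rpow_eq_one {N : ℕ} {s : ℝ} (hs : 0 < s) :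
    IsCompact {a : Fin N → ℝ | ∑ k, |a k| ^ s = 1} := by
  refine Metric.isCompact_of_isClosed_isBounded ?_ ?_
  · have : Continuous fun a : Fin N → ℝ => ∑ k, |a k| ^ s := by
      refine continuous_finsetSum _ fun k _ => ?_
      exact ((continuous_apply k).abs).rpow_const fun _ => Or.inr hs.le
    exact isClosed_eq this continuous_const
  · refine (Metric.isBounded_closedBall (x := (0 : Fin N → ℝ)) (r := 1)).subset fun a ha => ?_
    rw [mem_closedBall_zero_iff, pi_norm_le_iff_of_nonneg zero_le_one]
    intro k
    have h := abs_le_lrNorm hs a k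
    rw [lrNorm, show ∑ k, |a k| ^ s = 1 from ha, Real.one_rpow] at h
    exact h

/-- Random vectors whose `r`-th absolute moments approximate the `ℓ^s`-norm, for `r < s ≤ 2`. -/
theorem exists_moment_approx_of_lt {r s : ℝ} (hr : 0 < r) (hrs : r < s) (hs2 : s ≤ 2) (N : ℕ) :
    ∃ c : ℝ, 0 < c ∧ ∀ δ : ℝ, 0 < δ → ∃ (Ω : Type) (_ : MeasurableSpace Ω) (P : Measure Ω)
      (_ : IsProbabilityMeasure P) (g : Ω → Fin N → ℝ), Measurable g ∧
      (∀ a : Fin N → ℝ, Integrable (fun ω => |∑ k, a k * g ω k| ^ r) P) ∧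
      ∀ a : Fin N → ℝ, ∑ k, |a k| ^ s = 1 → |∫ ω, |∑ k, a k * g ω k| ^ r ∂P - c| < δ := by
  have hs : 0 < s := hr.trans hrs
  have hr2 : r < 2 := hrs.trans_le hs2
  obtain ⟨m, hm, φ, κ, D, hφ, hκ, hκ0, hκD, hκpos, hκc⟩ := exists_law_of_stable_attraction hs hs2
  have hD : 0 < D := hκpos.trans_le (hκD 0)
  have hφ1 : ∀ t, |φ t| ≤ 1 := fun t => by
    have := norm_charFun_le_one (μ := m) t
    rwa [hφ, Complex.norm_real] at this
  have hφm : Measurable φ := by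
    have h : Measurable fun t => (charFun m t).re := Complex.measurable_re.comp measurable_charFun
    simpa [hφ] using h
  have h1φ : ∀ t, 0 ≤ 1 - φ t := fun t => by linarith [(abs_le.1 (hφ1 t)).2]
  let P : ∀ n : ℕ, Measure (Fin N × Fin n → ℝ) := fun n => Measure.pi fun _ => m
  -- Each coordinate is a normalised sum of `n` independent copies, as in the stable limit theorem.
  let g : ∀ n : ℕ, (Fin N × Fin n → ℝ) → Fin N → ℝ := fun n ω k =>
    (n : ℝ) ^ (-(1 / s)) * ∑ i, ω (k, i)
  have hgm : ∀ n, Measurable (g n) := fun n => measurable_pi_iff.2 fun k => by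
    change Measurable fun ω : Fin N × Fin n → ℝ => (n : ℝ) ^ (-(1 / s)) * ∑ i, ω (k, i)
    fun_prop
  let u : ℕ → (Fin N → ℝ) → ℝ → Fin N → ℝ := fun n a t k => a k * (n : ℝ) ^ (-(1 / s)) * t
  let Φ : ℕ → (Fin N → ℝ) → ℝ → ℝ := fun n a t => ∏ k, φ (u n a t k) ^ n
  have hΦm : ∀ n a, Measurable (Φ n a) := fun n a => Finset.measurable_prod _ fun k _ =>
    (hφm.comp (measurable_id.const_mul _)).pow_const n
  have hΦ1 : ∀ n a t, |Φ n a t| ≤ 1 := fun n a t => by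
    rw [Finset.abs_prod]
    refine Finset.prod_le_one (fun _ _ => abs_nonneg _) fun k _ => ?_
    rw [abs_pow]
    exact pow_le_one₀ (abs_nonneg _) (hφ1 _)
  have hcos : ∀ n a t, ∫ ω, Real.cos ((∑ k, a k * g n ω k) * t) ∂P n = Φ n a t := by
    intro n a t
    have h := integral_cos_sum_pi m hφ fun z : Fin N × Fin n => u n a t z.1
    simp only [Fintype.prod_prod_type, Finset.prod_const, Finset.card_univ, Fintype.card_fin] at h
    refine Eq.trans ?_ h
    refine integral_congr_ae (Eventually.of_forall fun ω => ?_)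
    dsimp only
    congr 1
    rw [Fintype.sum_prod_type, Finset.sum_mul]
    refine Finset.sum_congr rfl fun k _ => ?_
    change a k * ((n : ℝ) ^ (-(1 / s)) * ∑ i, ω (k, i)) * t =
      ∑ i, a k * (n : ℝ) ^ (-(1 / s)) * t * ω (k, i)
    rw [← Finset.mul_sum]
    ring
  -- The normalisation `n^{-1/s}` exactly cancels the factor `n`.
  have hn1 : ∀ n : ℕ, 1 ≤ n → ∀ a t k, 0 < t →
      n * (1 - φ (u n a t k)) = |a k| ^ s * t ^ s * κ (u n a t k) := by
    intro n hn a t k ht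
    have hn0 : (0 : ℝ) < n := by exact_mod_cast hn
    rw [hκ, abs_mul, abs_mul, Real.mul_rpow (by positivity) (by positivity),
      Real.mul_rpow (by positivity) (by positivity), abs_of_pos ht,
      abs_of_pos (Real.rpow_pos_of_pos hn0 _), ← Real.rpow_mul hn0.le, neg_mul,
      one_div_mul_cancel hs.ne', Real.rpow_neg_one]
    field_simp
  have hbd : ∀ n : ℕ, 1 ≤ n → ∀ a t, 0 < t →
      1 - Φ n a t ≤ D * (∑ k, |a k| ^ s) * t ^ s := by
    intro n hn a t ht
    have h := one_sub_prod_le_sum (Finset.univ : Finset (Fin N × Fin n))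
      (x := fun z => φ (u n a t z.1)) fun z => hφ1 _
    simp only [Fintype.prod_prod_type, Fintype.sum_prod_type, Finset.prod_const, Finset.sum_const,
      Finset.card_univ, Fintype.card_fin, nsmul_eq_mul] at h
    refine h.trans ?_
    rw [mul_assoc, Finset.sum_mul, Finset.mul_sum]
    refine Finset.sum_le_sum fun k _ => ?_
    rw [hn1 n hn a t k ht, mul_comm]
    gcongr
    exact hκD _
  have hΦ0 : ∀ n a t, 0 ≤ 1 - Φ n a t := fun n a t => by linarith [(abs_le.1 (hΦ1 n a t)).2]
  have hΦ2 : ∀ n a t, 1 - Φ n a t ≤ 2 := fun n a t => by linarith [(abs_le.1 (hΦ1 n a t)).1]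
  have hAnn : ∀ a : Fin N → ℝ, 0 ≤ ∑ k, |a k| ^ s := fun a => sum_abs_rpow_nonneg s a
  have hmom : ∀ n : ℕ, 1 ≤ n → ∀ a : Fin N → ℝ,
      Integrable (fun ω => |∑ k, a k * g n ω k| ^ r) (P n) ∧
      (∫ ω, |∑ k, a k * g n ω k| ^ r ∂P n) * cosKernel r =
        ∫ t in Ioi (0 : ℝ), (1 - Φ n a t) * t ^ (-1 - r) := by
    intro n hn a
    have h := integral_abs_rpow_of_cos (P n) (Y := fun ω => ∑ k, a k * g n ω k)
      (Finset.measurable_sum _ fun k _ => ((measurable_pi_apply k).comp (hgm n)).const_mul _)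
      hr hr2
    simp only [hcos] at h
    refine h (integrableOn_mul_rpow_of_le hr hrs (D := D * ∑ k, |a k| ^ s)
      (measurable_const.sub (hΦm n a)) (fun t _ => hΦ0 n a t) (fun t _ => hΦ2 n a t)
      fun t ht => ?_)
    rw [abs_of_nonneg (mul_nonneg hD.le (hAnn a))]
    exact hbd n hn a t ht
  have hA : Continuous fun a : Fin N → ℝ => ∑ k, |a k| ^ s := by
    refine continuous_finsetSum _ fun k _ => ?_
    exact ((continuous_apply k).abs).rpow_const fun _ => Or.inr hs.le
  -- The limit is taken jointly in `n` and the coefficient vector, and it is the same at every point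
  -- of the sphere.
  have hlim : ∀ a₀ : Fin N → ℝ, ∑ k, |a₀ k| ^ s = 1 → ∀ t : ℝ, 0 < t →
      Tendsto (fun z : ℕ × (Fin N → ℝ) => Φ z.1 z.2 t) (atTop ×ˢ 𝓝 a₀)
        (𝓝 (Real.exp (-(κ 0 * t ^ s)))) := by
    intro a₀ ha₀ t ht
    have hexp : Real.exp (-(κ 0 * t ^ s)) = ∏ k, Real.exp (-(|a₀ k| ^ s * t ^ s * κ 0)) := by
      rw [← Real.exp_sum, Finset.sum_neg_distrib, ← Finset.sum_mul, ← Finset.sum_mul, ha₀]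
      ring_nf
    rw [hexp]
    refine tendsto_finsetProd _ fun k _ => ?_
    have hfst : Tendsto (fun z : ℕ × (Fin N → ℝ) => z.1) (atTop ×ˢ 𝓝 a₀) atTop := tendsto_fst
    have hak : Tendsto (fun z : ℕ × (Fin N → ℝ) => z.2 k) (atTop ×ˢ 𝓝 a₀) (𝓝 (a₀ k)) :=
      ((continuous_apply k).tendsto a₀).comp tendsto_snd
    have hu : Tendsto (fun z : ℕ × (Fin N → ℝ) => u z.1 z.2 t k) (atTop ×ˢ 𝓝 a₀) (𝓝 0) := by
      have h0 : Tendsto (fun n : ℕ => (n : ℝ) ^ (-(1 / s))) atTop (𝓝 0) :=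
        (tendsto_rpow_neg_atTop (by positivity)).comp tendsto_natCast_atTop_atTop
      have h2 := (hak.mul (h0.comp hfst)).mul_const t
      rw [mul_zero, zero_mul] at h2
      exact h2
    have h1 : Tendsto (fun z : ℕ × (Fin N → ℝ) => (z.1 : ℝ) * (1 - φ (u z.1 z.2 t k)))
        (atTop ×ˢ 𝓝 a₀) (𝓝 (|a₀ k| ^ s * t ^ s * κ 0)) := by
      have h2 : Tendsto (fun z : ℕ × (Fin N → ℝ) => |z.2 k| ^ s * t ^ s * κ (u z.1 z.2 t k))
          (atTop ×ˢ 𝓝 a₀) (𝓝 (|a₀ k| ^ s * t ^ s * κ 0)) :=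
        ((hak.abs.rpow_const (Or.inr hs.le)).mul_const _).mul (hκc.tendsto.comp hu)
      refine h2.congr' ?_
      filter_upwards [hfst.eventually_ge_atTop 1] with z hz
      rw [hn1 z.1 hz z.2 t k ht]
    have h3 := tendsto_one_sub_pow_exp hfst (fun z => h1φ (u z.1 z.2 t k)) h1
    simpa using h3
  set W : ℝ := ∫ t in Ioi (0 : ℝ), (1 - Real.exp (-(κ 0 * t ^ s))) * t ^ (-1 - r) with hW
  have hW0 : 0 < W := by
    have hz : ∀ t : ℝ, 0 < t → 0 < κ 0 * t ^ s := fun t ht => by positivity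
    have hlt : ∀ t : ℝ, 0 < t → 0 < 1 - Real.exp (-(κ 0 * t ^ s)) := fun t ht => by
      rw [sub_pos, Real.exp_lt_one_iff]
      linarith [hz t ht]
    refine setIntegral_mul_rpow_pos (integrableOn_mul_rpow_of_le hr hrs (D := κ 0) (by fun_prop)
      (fun t ht => (hlt t ht).le) (fun t _ => ?_) fun t _ => ?_) (fun t ht => (hlt t ht).le)
      fun t ht => hlt t ht.1
    · linarith [Real.exp_pos (-(κ 0 * t ^ s))]
    · rw [abs_of_pos hκpos]
      linarith [Real.add_one_le_exp (-(κ 0 * t ^ s))]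
  have hK := cosKernel_pos hr hr2
  have hmain : ∀ a₀ : Fin N → ℝ, ∑ k, |a₀ k| ^ s = 1 →
      Tendsto (fun z : ℕ × (Fin N → ℝ) => ∫ ω, |∑ k, z.2 k * g z.1 ω k| ^ r ∂P z.1)
        (atTop ×ˢ 𝓝 a₀) (𝓝 (W / cosKernel r)) := by
    intro a₀ ha₀
    have hfst : Tendsto (fun z : ℕ × (Fin N → ℝ) => z.1) (atTop ×ˢ 𝓝 a₀) atTop := tendsto_fst
    have hA2 : ∀ᶠ z : ℕ × (Fin N → ℝ) in atTop ×ˢ 𝓝 a₀, ∑ k, |z.2 k| ^ s < 2 := by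
      have h2 : Tendsto (fun z : ℕ × (Fin N → ℝ) => ∑ k, |z.2 k| ^ s) (atTop ×ˢ 𝓝 a₀) (𝓝 1) := by
        rw [← ha₀]
        exact (hA.tendsto a₀).comp tendsto_snd
      exact h2.eventually_lt_const (by norm_num)
    have hdom : Tendsto (fun z : ℕ × (Fin N → ℝ) =>
        ∫ t in Ioi (0 : ℝ), (1 - Φ z.1 z.2 t) * t ^ (-1 - r)) (atTop ×ˢ 𝓝 a₀) (𝓝 W) := by
      refine tendsto_integral_filter_of_dominated_convergence _
        (Eventually.of_forall fun z => ?_) ?_ (integrableOn_min_two_mul_rpow hr hrs (D * 2)) ?_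
      · exact ((measurable_const.sub (hΦm z.1 z.2)).mul
          (measurable_id.pow_const _)).aestronglyMeasurable
      · filter_upwards [hfst.eventually_ge_atTop 1, hA2] with z hz hz2
        filter_upwards [ae_restrict_mem measurableSet_Ioi] with t ht
        have ht0 : 0 < t := ht
        rw [Real.norm_of_nonneg (mul_nonneg (hΦ0 _ _ t) (by positivity))]
        gcongr
        refine le_min (hΦ2 _ _ t) ((hbd z.1 hz z.2 t ht0).trans ?_)
        rw [abs_of_pos (by positivity)]
        gcongr
      · filter_upwards [ae_restrict_mem measurableSet_Ioi] with t ht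
        exact (tendsto_const_nhds.sub (hlim a₀ ha₀ t ht)).mul_const _
    refine (hdom.div_const (cosKernel r)).congr' ?_
    filter_upwards [hfst.eventually_ge_atTop 1] with z hz
    rw [← (hmom z.1 hz z.2).2, mul_div_cancel_right₀ _ hK.ne']
  refine ⟨W / cosKernel r, div_pos hW0 hK, fun δ hδ => ?_⟩
  -- Joint convergence at each point is locally uniform convergence, hence uniform on the compact
  -- sphere.
  have hunif : TendstoUniformlyOn
      (fun (n : ℕ) (a : Fin N → ℝ) => ∫ ω, |∑ k, a k * g n ω k| ^ r ∂P n)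
      (fun _ => W / cosKernel r) atTop {a : Fin N → ℝ | ∑ k, |a k| ^ s = 1} := by
    rw [← tendstoLocallyUniformlyOn_iff_tendstoUniformlyOn_of_compact
      (isCompact_sum_abs_rpow_eq_one hs), tendstoLocallyUniformlyOn_iff_forall_tendsto]
    intro a₀ ha₀
    have h1 := (hmain a₀ ha₀).mono_left
      (prod_mono le_rfl (nhdsWithin_le_nhds (s := {a : Fin N → ℝ | ∑ k, |a k| ^ s = 1})))
    exact Uniform.tendsto_nhds_right.1 h1
  rw [Metric.tendstoUniformlyOn_iff] at hunif
  obtain ⟨n, hn, hn1'⟩ := ((hunif δ hδ).and (eventually_ge_atTop 1)).exists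
  refine ⟨_, inferInstance, P n, inferInstance, g n, hgm n, fun a => (hmom n hn1' a).1,
    fun a ha => ?_⟩
  have := hn a ha
  rwa [dist_comm, Real.dist_eq] at this

end stable

/-! ### Almost isometric embedding of `ℓ^s` into `ℓ^r` -/

section embedding

open Set Filter Topology

theorem lpNorm_ofReal_eq {Ω : Type*} [MeasurableSpace Ω] {P : Measure Ω} {r : ℝ} (hr : 0 < r)
    {Y : Ω → ℝ} (hY : AEStronglyMeasurable Y P) :
    lpNorm Y (ENNReal.ofReal r) P = (∫ ω, |Y ω| ^ r ∂P) ^ (1 / r) := by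
  rw [lpNorm_eq_integral_norm_rpow_toReal (by simpa using hr) ENNReal.ofReal_ne_top hY,
    ENNReal.toReal_ofReal hr.le, one_div]
  rfl

/-- For a simple random vector the `L^r`-norms of its linear images are `ℓ^r`-norms. -/
theorem lpNorm_simpleFunc_eq {Ω : Type*} [MeasurableSpace Ω] {P : Measure Ω}
    [IsProbabilityMeasure P] {r : ℝ} (hr : 0 < r) {N : ℕ} (σ : SimpleFunc Ω (Fin N → ℝ))
    (a : Fin N → ℝ) :
    lpNorm (fun ω => ∑ k, a k * σ ω k) (ENNReal.ofReal r) P =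
      lrNorm r fun v : σ.range => ∑ k, a k * (P.real (σ ⁻¹' {v.1}) ^ (1 / r) * v.1 k) := by
  have hm : AEStronglyMeasurable (fun ω => ∑ k, a k * σ ω k) P :=
    ((σ.map fun v : Fin N → ℝ => ∑ k, a k * v k).measurable).aestronglyMeasurable
  rw [lpNorm_ofReal_eq hr hm, lrNorm]
  congr 1
  have h1 : ∫ ω, |∑ k, a k * σ ω k| ^ r ∂P =
      ∑ v ∈ σ.range, P.real (σ ⁻¹' {v}) * |∑ k, a k * v k| ^ r := by
    have h2 := SimpleFunc.map_integral (μ := P) σ (fun v : Fin N → ℝ => |∑ k, a k * v k| ^ r)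
      (SimpleFunc.integrable_of_isFiniteMeasure σ) (by simp [Real.zero_rpow hr.ne'])
    rw [SimpleFunc.integral_eq_integral _ (SimpleFunc.integrable_of_isFiniteMeasure _)] at h2
    exact h2
  rw [h1, ← Finset.sum_coe_sort]
  refine Finset.sum_congr rfl fun v _ => ?_
  have h2 : ∑ k, a k * (P.real (σ ⁻¹' {v.1}) ^ (1 / r) * v.1 k) =
      P.real (σ ⁻¹' {v.1}) ^ (1 / r) * ∑ k, a k * v.1 k := by
    rw [Finset.mul_sum]
    exact Finset.sum_congr rfl fun k _ => by ring
  rw [h2, abs_mul, Real.mul_rpow (abs_nonneg _) (abs_nonneg _),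
    abs_of_nonneg (Real.rpow_nonneg measureReal_nonneg _), ← Real.rpow_mul measureReal_nonneg,
    one_div_mul_cancel hr.ne', Real.rpow_one]

/-- A simple random vector close in `L^r` to the one of `exists_moment_approx_of_lt` takes finitely
many values; its atoms, weighted by the `r`-th roots of their probabilities, are the rows of the
matrix. -/
theorem exists_almost_isometric_embedding {r s : ℝ} (hr : 1 ≤ r) (hrs : r < s) (hs2 : s ≤ 2)
    (N : ℕ) {ε : ℝ} (hε : 0 < ε) :
    ∃ (M : ℕ) (g : Fin M → Fin N → ℝ), ∀ a : Fin N → ℝ,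
      lrNorm s a ≤ lrNorm r (fun j => ∑ k, a k * g j k) ∧
      lrNorm r (fun j => ∑ k, a k * g j k) ≤ (1 + ε) * lrNorm s a := by
  have hr0 : 0 < r := by linarith
  have hs0 : 0 < s := by linarith
  have hr' : (1 : ℝ≥0∞) ≤ ENNReal.ofReal r := by simpa using hr
  -- By homogeneity it is enough to treat the unit sphere of `ℓ^s`.
  suffices h : ∃ (ι : Type) (_ : Fintype ι) (g : ι → Fin N → ℝ), ∀ a : Fin N → ℝ,
      lrNorm s a = 1 → 1 ≤ lrNorm r (fun j => ∑ k, a k * g j k) ∧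
      lrNorm r (fun j => ∑ k, a k * g j k) ≤ 1 + ε by
    obtain ⟨ι, _, g, hg⟩ := h
    let e := (Fintype.equivFin ι).symm
    refine ⟨Fintype.card ι, fun j => g (e j), fun a => ?_⟩
    have he : lrNorm r (fun j => ∑ k, a k * g (e j) k) = lrNorm r fun j => ∑ k, a k * g j k := by
      unfold lrNorm
      rw [Equiv.sum_comp e fun j => |∑ k, a k * g j k| ^ r]
    rw [he]
    rcases (lrNorm_nonneg (r := s) a).eq_or_lt with h0 | h0
    · have ha : ∀ k, a k = 0 := fun k => by
        have := abs_le_lrNorm hs0 a k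
        rw [← h0] at this
        exact abs_eq_zero.1 (le_antisymm this (abs_nonneg _))
      rw [← h0]
      simp [ha, lrNorm, Real.zero_rpow hr0.ne', Real.zero_rpow (inv_ne_zero hr0.ne')]
    · have h1 := hg (fun k => (lrNorm s a)⁻¹ * a k) (by
        rw [lrNorm_smul hs0, abs_of_pos (inv_pos.2 h0), inv_mul_cancel₀ h0.ne'])
      have h2 : (fun j => ∑ k, (lrNorm s a)⁻¹ * a k * g j k) =
          fun j => (lrNorm s a)⁻¹ * ∑ k, a k * g j k := by
        funext j
        rw [Finset.mul_sum]
        exact Finset.sum_congr rfl fun k _ => by ring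
      rw [h2, lrNorm_smul hr0, abs_of_pos (inv_pos.2 h0), le_inv_mul_iff₀ h0,
        inv_mul_le_iff₀ h0, mul_one, mul_comm (lrNorm s a)] at h1
      exact h1
  -- Moment approximation and discretisation each cost a relative error `η`; this value solves `1 +
  -- 2η = (1 + ε)(1 - 2η)`.
  set η : ℝ := ε / (2 * (2 + ε)) with hη
  have hη0 : 0 < η := by positivity
  have hη1 : 2 * η < 1 := by
    rw [hη, ← mul_div_assoc, div_lt_one (by positivity)]
    linarith
  have hηε : 1 + 2 * η ≤ (1 + ε) * (1 - 2 * η) := by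
    have : 2 * η * (2 + ε) = ε := by
      rw [hη]
      field_simp
    linarith
  obtain ⟨c₀, hc₀, happ⟩ := exists_moment_approx_of_lt hr0 hrs hs2 N
  set c : ℝ := c₀ ^ (1 / r) with hc
  have hcpos : 0 < c := by positivity
  have hcr : c ^ r = c₀ := by
    rw [hc, ← Real.rpow_mul hc₀.le, one_div_mul_cancel hr0.ne', Real.rpow_one]
  have hlow : (c * (1 - η)) ^ r < c₀ := by
    rw [← hcr]
    exact Real.rpow_lt_rpow (mul_nonneg hcpos.le (by linarith)) (by nlinarith) hr0
  have hup : c₀ < (c * (1 + η)) ^ r := by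
    rw [← hcr]
    exact Real.rpow_lt_rpow hcpos.le (by nlinarith) hr0
  obtain ⟨Ω, _, P, _, g, hgm, hgi, hg⟩ := happ (min (c₀ - (c * (1 - η)) ^ r)
    ((c * (1 + η)) ^ r - c₀)) (lt_min (sub_pos.2 hlow) (sub_pos.2 hup))
  have hgk : ∀ k, Measurable fun ω => g ω k := fun k => (measurable_pi_apply k).comp hgm
  have hYm : ∀ a : Fin N → ℝ, Measurable fun ω => ∑ k, a k * g ω k := fun a =>
    Finset.measurable_sum _ fun k _ => (hgk k).const_mul _
  have hYL : ∀ a : Fin N → ℝ, MemLp (fun ω => ∑ k, a k * g ω k) (ENNReal.ofReal r) P := fun a => by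
    rw [← integrable_norm_rpow_iff (hYm a).aestronglyMeasurable (by simpa using hr0)
      ENNReal.ofReal_ne_top, ENNReal.toReal_ofReal hr0.le]
    exact hgi a
  have hgL : MemLp g (ENNReal.ofReal r) P := by
    have h1 : ∀ k, MemLp (fun ω => |g ω k|) (ENNReal.ofReal r) P := fun k => by
      have h := hYL (Pi.single k 1)
      simp only [Pi.single_apply, ite_mul, one_mul, zero_mul, Finset.sum_ite_eq',
        Finset.mem_univ, if_true] at h
      exact h.abs
    refine (memLp_finsetSum Finset.univ fun k _ => h1 k).of_le hgm.aestronglyMeasurable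
      (Eventually.of_forall fun ω => ?_)
    have h0 : 0 ≤ ∑ k, |g ω k| := Finset.sum_nonneg fun _ _ => abs_nonneg _
    rw [Real.norm_of_nonneg h0, pi_norm_le_iff_of_nonneg h0]
    exact fun k => Finset.single_le_sum (f := fun k => |g ω k|) (fun _ _ => abs_nonneg _)
      (Finset.mem_univ k)
  -- On the sphere every `|a k| ≤ 1`, so the linear form magnifies the sup-norm error by at most
  -- `N`; `N + 1` also covers `N = 0`.
  set τ : ℝ := c * η / (N + 1) with hτ
  have hτ0 : 0 < τ := by positivity
  obtain ⟨σ, hσ, hσL⟩ := hgL.exists_simpleFunc_eLpNorm_sub_lt ENNReal.ofReal_ne_top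
    (ENNReal.ofReal_pos.2 hτ0).ne'
  have hσ' : lpNorm (g - ⇑σ) (ENNReal.ofReal r) P ≤ τ := by
    rw [← ofReal_lpNorm (hgL.sub hσL)] at hσ
    exact ((ENNReal.ofReal_lt_ofReal_iff hτ0).1 hσ).le
  have hZm : ∀ a : Fin N → ℝ, Measurable fun ω => ∑ k, a k * σ ω k := fun a =>
    (σ.map fun v : Fin N → ℝ => ∑ k, a k * v k).measurable
  have hdiff : ∀ a : Fin N → ℝ, lrNorm s a = 1 →
      MemLp ((fun ω => ∑ k, a k * g ω k) - fun ω => ∑ k, a k * σ ω k) (ENNReal.ofReal r) P ∧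
      lpNorm ((fun ω => ∑ k, a k * g ω k) - fun ω => ∑ k, a k * σ ω k) (ENNReal.ofReal r) P
        ≤ c * η := by
    intro a ha
    have hpt : ∀ ω, ‖((fun ω => ∑ k, a k * g ω k) - fun ω => ∑ k, a k * σ ω k) ω‖ ≤
        (N : ℝ) * ‖(g - ⇑σ) ω‖ := fun ω => by
      rw [Pi.sub_apply, ← Finset.sum_sub_distrib]
      refine (norm_sum_le _ _).trans ?_
      have : ∀ k ∈ Finset.univ, ‖a k * g ω k - a k * σ ω k‖ ≤ ‖(g - ⇑σ) ω‖ := fun k _ => by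
        rw [← mul_sub, norm_mul]
        have h1 : ‖a k‖ ≤ 1 := by
          rw [← ha]
          exact abs_le_lrNorm hs0 a k
        calc ‖a k‖ * ‖g ω k - σ ω k‖ ≤ 1 * ‖(g - ⇑σ) ω‖ := by
              gcongr
              exact norm_le_pi_norm ((g - ⇑σ) ω) k
          _ = _ := one_mul _
      simpa using Finset.sum_le_card_nsmul _ _ _ this
    have hL := ((hgL.sub hσL).norm).const_mul (N : ℝ)
    refine ⟨hL.of_le ((hYm a).sub (hZm a)).aestronglyMeasurable (Eventually.of_forall fun ω =>
      (hpt ω).trans (le_abs_self _)), ?_⟩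
    refine (lpNorm_mono_real hL hpt).trans ?_
    have e : lpNorm (fun ω => (N : ℝ) * ‖(g - ⇑σ) ω‖) (ENNReal.ofReal r) P =
        N * lpNorm (g - ⇑σ) (ENNReal.ofReal r) P := by
      rw [lpNorm_fun_natCast_mul, lpNorm_norm (hgL.sub hσL).1]
    rw [e]
    calc (N : ℝ) * lpNorm (g - ⇑σ) (ENNReal.ofReal r) P ≤ (N + 1) * τ :=
          mul_le_mul (by linarith) hσ' lpNorm_nonneg (by positivity)
      _ = c * η := by
          rw [hτ]
          field_simp
  -- Dividing by the lower bound `c (1 - 2η)` makes the lower estimate exact.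
  refine ⟨σ.range, inferInstance, fun v k => (c * (1 - 2 * η))⁻¹ *
    (P.real (σ ⁻¹' {v.1}) ^ (1 / r) * v.1 k), fun a ha => ?_⟩
  have hden : 0 < c * (1 - 2 * η) := mul_pos hcpos (by linarith)
  have e1 : lrNorm r (fun v : σ.range => ∑ k, a k * ((c * (1 - 2 * η))⁻¹ *
      (P.real (σ ⁻¹' {v.1}) ^ (1 / r) * v.1 k))) = (c * (1 - 2 * η))⁻¹ *
      lpNorm (fun ω => ∑ k, a k * σ ω k) (ENNReal.ofReal r) P := by
    rw [lpNorm_simpleFunc_eq hr0, ← abs_of_pos (inv_pos.2 hden), ← lrNorm_smul hr0,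
      abs_of_pos (inv_pos.2 hden)]
    congr 1
    funext v
    rw [Finset.mul_sum]
    exact Finset.sum_congr rfl fun k _ => by ring
  rw [e1, le_inv_mul_iff₀ hden, inv_mul_le_iff₀ hden, mul_one]
  obtain ⟨hdL, hd⟩ := hdiff a ha
  have ha' : ∑ k, |a k| ^ s = 1 := by
    rw [← lrNorm_rpow hs0, ha, Real.one_rpow]
  have hE := abs_lt.1 (hg a ha')
  have hE1 := min_le_left (c₀ - (c * (1 - η)) ^ r) ((c * (1 + η)) ^ r - c₀)
  have hE2 := min_le_right (c₀ - (c * (1 - η)) ^ r) ((c * (1 + η)) ^ r - c₀)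
  have hInn : 0 ≤ ∫ ω, |∑ k, a k * g ω k| ^ r ∂P :=
    integral_nonneg fun ω => Real.rpow_nonneg (abs_nonneg _) _
  have hY1 : c * (1 - η) ≤ lpNorm (fun ω => ∑ k, a k * g ω k) (ENNReal.ofReal r) P := by
    rw [lpNorm_ofReal_eq hr0 (hYm a).aestronglyMeasurable, one_div,
      Real.le_rpow_inv_iff_of_pos (mul_nonneg hcpos.le (by linarith)) hInn hr0]
    linarith [hE.1]
  have hY2 : lpNorm (fun ω => ∑ k, a k * g ω k) (ENNReal.ofReal r) P ≤ c * (1 + η) := by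
    rw [lpNorm_ofReal_eq hr0 (hYm a).aestronglyMeasurable, one_div,
      Real.rpow_inv_le_iff_of_pos hInn (mul_nonneg hcpos.le (by linarith)) hr0]
    linarith [hE.2]
  have hZL : MemLp (fun ω => ∑ k, a k * σ ω k) (ENNReal.ofReal r) P := by
    have := (hYL a).sub hdL
    rwa [sub_sub_cancel] at this
  have ht1 := lpNorm_le_lpNorm_add_lpNorm_sub' (f := fun ω => ∑ k, a k * g ω k) hZL hr'
  have ht2 := lpNorm_le_lpNorm_add_lpNorm_sub (f := fun ω => ∑ k, a k * σ ω k) (hYL a) hr'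
  constructor
  · linarith
  · nlinarith

end embedding

/-! ### Duality: quotient maps and measurable lifts -/

section duality

theorem sum_mul_le_lrNorm_mul_lrNorm {ι : Type*} [Fintype ι] {p q : ℝ} (hpq : p.HolderConjugate q)
    (a b : ι → ℝ) : ∑ k, a k * b k ≤ lrNorm p a * lrNorm q b :=
  Real.inner_le_Lp_mul_Lq Finset.univ a b hpq

/-- Test with the extremal vector `sign (b k) |b k|^{q-1}` and divide by `‖b‖_q^{q-1}`. -/
theorem lrNorm_le_of_forall_sum_mul_le {ι : Type*} [Fintype ι] {p q : ℝ}
    (hpq : p.HolderConjugate q) {b : ι → ℝ} {c : ℝ} (hc : 0 ≤ c)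
    (h : ∀ a : ι → ℝ, ∑ k, a k * b k ≤ c * lrNorm p a) : lrNorm q b ≤ c := by
  have hq := hpq.symm.pos
  rcases (lrNorm_nonneg (r := q) b).eq_or_lt with h0 | h0
  · rwa [← h0]
  have hq1 : (q - 1) * p = q := hpq.symm.sub_one_mul_conj
  set a : ι → ℝ := fun k => SignType.sign (b k) * |b k| ^ (q - 1) with ha
  have h1 : ∀ k, a k * b k = |b k| ^ q := fun k => by
    rcases eq_or_ne (b k) 0 with hb | hb
    · rw [hb, mul_zero, abs_zero, Real.zero_rpow hq.ne']
    · calc a k * b k = |b k| ^ (q - 1) * (SignType.sign (b k) * b k) := by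
            rw [ha]
            ring
        _ = |b k| ^ q := by
            rw [sign_mul_self, Real.rpow_sub_one (abs_pos.2 hb).ne',
              div_mul_cancel₀ _ (abs_pos.2 hb).ne']
  have h2 : ∀ k, |a k| ^ p = |b k| ^ q := fun k => by
    rcases eq_or_ne (b k) 0 with hb | hb
    · rw [ha]
      simp [hb, Real.zero_rpow hq.ne', Real.zero_rpow hpq.pos.ne']
    · have : |a k| = |b k| ^ (q - 1) := by
        rw [ha]
        rcases lt_or_gt_of_ne hb with hb | hb
        · simp [sign_neg hb, abs_of_nonneg (Real.rpow_nonneg (abs_nonneg (b k)) (q - 1))]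
        · simp [sign_pos hb, abs_of_nonneg (Real.rpow_nonneg (abs_nonneg (b k)) (q - 1))]
      rw [this, ← Real.rpow_mul (abs_nonneg _), hq1]
  have h3 := h a
  have h4 : lrNorm p a = lrNorm q b ^ (q - 1) := by
    rw [lrNorm, Finset.sum_congr rfl fun k _ => h2 k, ← lrNorm_rpow hq, ← Real.rpow_mul h0.le]
    congr 1
    rw [mul_one_div, div_eq_iff hpq.pos.ne', hq1]
  rw [Finset.sum_congr rfl fun k _ => h1 k, ← lrNorm_rpow hq, h4] at h3
  have h5 : lrNorm q b ^ q = lrNorm q b * lrNorm q b ^ (q - 1) := by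
    rw [Real.rpow_sub_one h0.ne', mul_div_cancel₀ _ h0.ne']
  rw [h5] at h3
  exact le_of_mul_le_mul_right h3 (Real.rpow_pos_of_pos h0 _)

variable {M N : ℕ} {r s r' s' : ℝ}

/-- The transpose of a bounded map `ℓ^{r'} → ℓ^{s'}` is bounded `ℓ^s → ℓ^r`. -/
theorem lrNorm_transpose_le (hr : r'.HolderConjugate r) (hs : s'.HolderConjugate s)
    {g : Fin M → Fin N → ℝ} {K : ℝ} (hK : 0 ≤ K)
    (hg : ∀ a : Fin N → ℝ, lrNorm s' (fun j => ∑ k, a k * g j k) ≤ K * lrNorm r' a)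
    (b : Fin M → ℝ) : lrNorm r (fun k => ∑ j, g j k * b j) ≤ K * lrNorm s b := by
  refine lrNorm_le_of_forall_sum_mul_le hr (mul_nonneg hK (lrNorm_nonneg _)) fun a => ?_
  calc ∑ k, a k * ∑ j, g j k * b j = ∑ j, (∑ k, a k * g j k) * b j := by
        simp only [Finset.mul_sum, Finset.sum_mul]
        rw [Finset.sum_comm]
        exact Finset.sum_congr rfl fun j _ => Finset.sum_congr rfl fun k _ => by ring
    _ ≤ lrNorm s' (fun j => ∑ k, a k * g j k) * lrNorm s b := sum_mul_le_lrNorm_mul_lrNorm hs _ _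
    _ ≤ K * lrNorm r' a * lrNorm s b := by
        gcongr
        · exact lrNorm_nonneg _
        · exact hg a
    _ = K * lrNorm s b * lrNorm r' a := by ring

/-- The transpose of a map `ℓ^{r'} → ℓ^{s'}` bounded below is a quotient map `ℓ^s → ℓ^r`. -/
theorem exists_lift_of_lrNorm_le (hr : r'.HolderConjugate r) (hs : s'.HolderConjugate s)
    {g : Fin M → Fin N → ℝ}
    (hg : ∀ a : Fin N → ℝ, lrNorm r' a ≤ lrNorm s' (fun j => ∑ k, a k * g j k))
    (y : Fin N → ℝ) :
    ∃ b : Fin M → ℝ, (∀ k, ∑ j, g j k * b j = y k) ∧ lrNorm s b ≤ lrNorm r y := by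
  let J : (Fin N → ℝ) →ₗ[ℝ] (Fin M → ℝ) :=
    { toFun := fun a j => ∑ k, a k * g j k
      map_add' := fun a b => by
        funext j
        simp [add_mul, Finset.sum_add_distrib]
      map_smul' := fun c a => by
        funext j
        simp [mul_assoc, Finset.mul_sum] }
  have hJ : ∀ a, J a = fun j => ∑ k, a k * g j k := fun a => rfl
  have hinj : Function.Injective J := by
    rw [← LinearMap.ker_eq_bot, LinearMap.ker_eq_bot']
    intro a ha
    have h1 := hg a
    rw [← hJ, ha] at h1
    have h2 : lrNorm s' (0 : Fin M → ℝ) = 0 := by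
      have := hs.pos.ne'
      simp [lrNorm, Real.zero_rpow this, Real.zero_rpow (inv_ne_zero this)]
    funext k
    have h3 := (abs_le_lrNorm hr.pos a k).trans h1
    rw [h2] at h3
    exact abs_eq_zero.1 (le_antisymm h3 (abs_nonneg _))
  let e := LinearEquiv.ofInjective J hinj
  let pair : (Fin N → ℝ) →ₗ[ℝ] ℝ :=
    { toFun := fun a => ∑ k, a k * y k
      map_add' := fun a b => by simp [add_mul, Finset.sum_add_distrib]
      map_smul' := fun c a => by simp [mul_assoc, Finset.mul_sum] }
  -- The functional `J a ↦ ∑ a k * y k` is at most `‖y‖_r ‖J a‖_{s'}` by Hölder and the lower bound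
  -- on `J`. The coordinates of a Hahn–Banach extension form the lift.
  let f : (Fin M → ℝ) →ₗ.[ℝ] ℝ := ⟨LinearMap.range J, pair ∘ₗ e.symm.toLinearMap⟩
  have hf : ∀ a, f (e a) = ∑ k, a k * y k := fun a => by
    change pair (e.symm (e a)) = _
    rw [e.symm_apply_apply]
    rfl
  obtain ⟨φ, hφf, hφ⟩ := exists_extension_of_le_sublinear f
    (fun x => lrNorm r y * lrNorm s' x)
    (fun c hc x => by
      have := lrNorm_smul hs.pos c x
      rw [abs_of_pos hc] at this
      change lrNorm r y * lrNorm s' (fun k => c * x k) = _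
      rw [this]
      ring)
    (fun x z => by
      rw [← mul_add]
      exact mul_le_mul_of_nonneg_left (lrNorm_add_le hs.lt.le x z) (lrNorm_nonneg _))
    (fun x => by
      obtain ⟨a, rfl⟩ := e.surjective x
      rw [hf]
      refine (sum_mul_le_lrNorm_mul_lrNorm hr a y).trans ?_
      rw [mul_comm]
      exact mul_le_mul_of_nonneg_left (hg a) (lrNorm_nonneg _))
  have hsum : ∀ x : Fin M → ℝ, φ x = ∑ j, x j * φ (Pi.single j 1) := fun x => by
    rw [LinearMap.pi_apply_eq_sum_univ φ x]
    refine Finset.sum_congr rfl fun j _ => ?_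
    rw [smul_eq_mul]
    congr 2
    funext i
    simp [Pi.single_apply, eq_comm]
  refine ⟨fun j => φ (Pi.single j 1), fun k => ?_, ?_⟩
  · have h1 := hφf (e (Pi.single k 1))
    rw [hf] at h1
    have h2 : ((e (Pi.single k 1) : LinearMap.range J) : Fin M → ℝ) = fun j => g j k := by
      change J (Pi.single k 1) = _
      rw [hJ]
      funext j
      simp [Pi.single_apply]
    rw [h2, hsum] at h1
    rw [h1]
    simp [Pi.single_apply]
  · refine lrNorm_le_of_forall_sum_mul_le hs (lrNorm_nonneg _) fun a => ?_
    rw [← hsum]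
    exact hφ a

theorem measurable_lrNorm {ι : Type*} [Fintype ι] (r : ℝ) :
    Measurable fun a : ι → ℝ => lrNorm r a :=
  (Finset.measurable_sum _ fun k _ => ((measurable_pi_apply k).abs.pow_const r)).pow_const _

/-- A measurable right inverse, of norm at most `2`, of a quotient map `ℓ^s → ℓ^r`. -/
theorem exists_measurable_lift (hr : 1 ≤ r) (hs : 1 ≤ s) {g : Fin M → Fin N → ℝ}
    (hg : ∀ y : Fin N → ℝ,
      ∃ b : Fin M → ℝ, (∀ k, ∑ j, g j k * b j = y k) ∧ lrNorm s b ≤ lrNorm r y) :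
    ∃ Ψ : (Fin N → ℝ) → Fin M → ℝ, Measurable Ψ ∧ (∀ y k, ∑ j, g j k * Ψ y j = y k) ∧
      ∀ y, lrNorm s (Ψ y) ≤ 2 * lrNorm r y := by
  classical
  have hr0 : 0 < r := by linarith
  have hs0 : 0 < s := by linarith
  choose β hβ hβn using hg
  -- A linear, hence measurable, right inverse, but with norm bound only `N`. It will be used just
  -- on a small remainder, the main part being lifted by `β` at countably many points.
  let L : (Fin N → ℝ) → Fin M → ℝ := fun y j => ∑ k, y k * β (Pi.single k 1) j
  have hLm : Measurable L := by
    refine measurable_pi_iff.2 fun j => ?_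
    exact Finset.measurable_sum _ fun k _ => (measurable_pi_apply k).mul_const _
  have hLg : ∀ y k, ∑ j, g j k * L y j = y k := fun y k => by
    calc ∑ j, g j k * L y j = ∑ i, y i * ∑ j, g j k * β (Pi.single i 1) j := by
          simp only [L, Finset.mul_sum]
          rw [Finset.sum_comm]
          exact Finset.sum_congr rfl fun j _ => Finset.sum_congr rfl fun k _ => by ring
      _ = y k := by
          simp [hβ, Pi.single_apply]
  have hzero : ∀ {ι : Type} [Fintype ι] {t : ℝ}, 0 < t → lrNorm t (fun _ : ι => 0) = 0 := by
    intro ι _ t ht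
    simp [lrNorm, Real.zero_rpow ht.ne', Real.zero_rpow (inv_ne_zero ht.ne')]
  have hLn : ∀ y, lrNorm s (L y) ≤ N * lrNorm r y := fun y => by
    have h1 : ∀ S : Finset (Fin N), lrNorm s (fun j => ∑ k ∈ S, y k * β (Pi.single k 1) j) ≤
        ∑ k ∈ S, lrNorm r y := fun S => by
      induction S using Finset.induction_on with
      | empty => simpa using (hzero hs0).le
      | insert k S hk ih =>
        simp only [Finset.sum_insert hk]
        refine (lrNorm_add_le hs _ _).trans (add_le_add ?_ ih)
        rw [lrNorm_smul hs0]
        have h2 : lrNorm s (β (Pi.single k 1)) ≤ 1 := by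
          refine (hβn _).trans ((lrNorm_le_sum hr _).trans ?_)
          simp [Pi.single_apply, apply_ite abs]
        calc |y k| * lrNorm s (β (Pi.single k 1)) ≤ lrNorm r y * 1 :=
              mul_le_mul (abs_le_lrNorm hr0 y k) h2 (lrNorm_nonneg _) (lrNorm_nonneg _)
          _ = _ := mul_one _
    simpa using h1 Finset.univ
  -- The vector 0 is prepended because for `y = 0` the remainder must vanish exactly.
  let v : ℕ → Fin N → ℝ := fun i => Nat.casesOn i 0 (TopologicalSpace.denseSeq (Fin N → ℝ))
  have hex : ∀ y, ∃ i, (N + 1) * lrNorm r (fun k => y k - v i k) ≤ lrNorm r y := fun y => by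
    rcases (lrNorm_nonneg (r := r) y).eq_or_lt with h0 | h0
    · refine ⟨0, ?_⟩
      have : (fun k => y k - v 0 k) = y := by
        funext k
        simp [v]
      rw [this, ← h0, mul_zero]
    · obtain ⟨i, hi⟩ := (TopologicalSpace.denseRange_denseSeq (Fin N → ℝ)).exists_dist_lt y
        -- One factor `N + 1` pays for passing from the sup norm to the `ℓ^r`-norm, the other for
        -- the factor in `hex`.
        (ε := lrNorm r y / ((N + 1) * (N + 1))) (by positivity)
      refine ⟨i + 1, ?_⟩
      have h1 : lrNorm r (fun k => y k - v (i + 1) k) ≤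
          N * (lrNorm r y / ((N + 1) * (N + 1))) := by
        refine (lrNorm_le_sum hr _).trans ?_
        have h2 : ∀ k ∈ Finset.univ, |y k - v (i + 1) k| ≤ lrNorm r y / ((N + 1) * (N + 1)) :=
          fun k _ => by
            rw [← Real.dist_eq]
            exact (dist_le_pi_dist y (v (i + 1)) k).trans hi.le
        simpa using Finset.sum_le_card_nsmul _ _ _ h2
      calc ((N : ℝ) + 1) * lrNorm r (fun k => y k - v (i + 1) k)
          ≤ (N + 1) * ((N + 1) * (lrNorm r y / ((N + 1) * (N + 1)))) := by
            gcongr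
            refine h1.trans ?_
            gcongr
            linarith
        _ = lrNorm r y := by field_simp
  have hmfind : Measurable fun y => Nat.find (hex y) := by
    refine measurable_find hex fun i => ?_
    refine measurableSet_le (Measurable.const_mul ?_ _) (measurable_lrNorm r)
    exact (measurable_lrNorm r).comp (measurable_pi_iff.2 fun k =>
      (measurable_pi_apply k).sub_const _)
  have hmv : ∀ {α : Type} [MeasurableSpace α] (w : ℕ → α),
      Measurable fun y => w (Nat.find (hex y)) := fun w => (measurable_from_nat (f := w)).comp hmfind
  -- Choosing the first good index makes this measurable. With remainder `d = ‖y - v i‖_r`, the norm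
  -- is at most `‖v i‖ + N d ≤ ‖y‖ + (N + 1) d ≤ 2 ‖y‖`.
  refine ⟨fun y j => β (v (Nat.find (hex y))) j + L (fun k => y k - v (Nat.find (hex y)) k) j,
    ?_, fun y k => ?_, fun y => ?_⟩
  · refine measurable_pi_iff.2 fun j => ?_
    refine (hmv fun i => β (v i) j).add ((measurable_pi_iff.1 hLm j).comp ?_)
    exact measurable_pi_iff.2 fun k => (measurable_pi_apply k).sub (hmv fun i => v i k)
  · simp only [mul_add, Finset.sum_add_distrib, hβ, hLg]
    ring
  · set i := Nat.find (hex y)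
    have hi : (N + 1) * lrNorm r (fun k => y k - v i k) ≤ lrNorm r y := Nat.find_spec (hex y)
    have h1 := lrNorm_add_le hs (β (v i)) (L fun k => y k - v i k)
    have h2 := hLn fun k => y k - v i k
    have h3 := hβn (v i)
    have h4 : lrNorm r (v i) ≤ lrNorm r y + lrNorm r (fun k => y k - v i k) := by
      have h5 := lrNorm_add_le hr y (fun k => (-1) * (y k - v i k))
      rw [lrNorm_smul hr0, abs_neg, abs_one, one_mul] at h5
      have h6 : (fun k => y k + (-1) * (y k - v i k)) = v i := by
        funext k
        ring
      rwa [h6] at h5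
    linarith

end duality

theorem VarLp.ellrFun_sum_smul {Ω : Type*} [MeasurableSpace Ω] {ρ : Measure Ω}
    {t : VarExponent Ω} {M N : ℕ} (r : ℝ) (g : Fin M → Fin N → ℝ) (h : Fin N → VarLp t ρ) :
    ellrFun r (fun j => (∑ k, g j k • h k : VarLp t ρ)) =ᵐ[ρ]
      fun x => lrNorm r fun j => ∑ k, h k x * g j k := by
  filter_upwards [ae_all_iff.2 fun j => VarLp.coeFn_sum_smul Finset.univ (g j) h] with x hx
  rw [ellrFun_apply]
  simp only [hx, mul_comm (g _ _)]

/-! ### Change of the inner exponent and the theorem -/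

section mz

variable {Ω₁ Ω₂ : Type*} [MeasurableSpace Ω₁] [MeasurableSpace Ω₂] {ν : Measure Ω₁}
  {μ : Measure Ω₂} {q : VarExponent Ω₂} {p : VarExponent Ω₁}

/-- The bound for `r` is applied to the combinations `∑ₖ g j k • fₖ`, which `T` respects; the
embedding is then used pointwise on both sides. -/
theorem IsMZBound.of_lt_of_le_two {r s : ℝ} (hr : 1 ≤ r) (hrs : r < s) (hs2 : s ≤ 2) {C : ℝ≥0}
    (hC : IsMZBound μ ν q p r C) {ε : ℝ≥0} (hε : 0 < ε) :
    IsMZBound μ ν q p s ((1 + ε) * C) := by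
  intro T N f
  obtain ⟨M, g, hg⟩ := exists_almost_isometric_embedding hr hrs hs2 N (ε := ε) (by exact_mod_cast hε)
  have hmain := hC T M fun j => ∑ k, g j k • f k
  simp only [map_sum, map_smul] at hmain
  have h1 : varENorm p ν (ellrFun s fun k => T (f k)) ≤
      varENorm p ν (ellrFun r fun j => (∑ k, g j k • T (f k) : VarLp p ν)) := by
    refine varENorm_mono ?_
    filter_upwards [VarLp.ellrFun_sum_smul r g fun k => T (f k)] with x hx
    rw [hx, abs_of_nonneg (ellrFun_nonneg _ _), abs_of_nonneg (lrNorm_nonneg _)]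
    exact (hg _).1
  have h2 : varENorm q μ (ellrFun r fun j => (∑ k, g j k • f k : VarLp q μ)) ≤
      (1 + ε : ℝ≥0) * varENorm q μ (ellrFun s fun k => f k) := by
    have e : ((1 + ε : ℝ≥0) : ℝ≥0∞) = ‖(1 + ε : ℝ)‖ₑ := by
      rw [Real.enorm_of_nonneg (by positivity), ← NNReal.coe_one, ← NNReal.coe_add,
        ENNReal.ofReal_coe_nnreal]
    rw [e, ← varENorm_const_mul]
    refine varENorm_mono ?_
    filter_upwards [VarLp.ellrFun_sum_smul r g f] with x hx
    rw [hx, abs_of_nonneg (lrNorm_nonneg _),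
      abs_of_nonneg (mul_nonneg (by positivity) (ellrFun_nonneg _ _))]
    exact (hg _).2
  refine (h1.trans hmain).trans ((mul_le_mul_right h2 _).trans (le_of_eq ?_))
  push_cast
  ring

/-- The bound for `s` is applied to a lift of `(fₖ)` along the quotient map `ℓ^s → ℓ^r`, and the
transpose recovers `T fₖ`; lift and transpose cost 2 each. -/
theorem IsMZBound.of_two_le_of_lt {r s : ℝ} (hr : 2 ≤ r) (hrs : r < s) {C : ℝ≥0}
    (hC : IsMZBound μ ν q p s C) : IsMZBound μ ν q p r (4 * C) := by
  intro T N f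
  have hr1 : 1 ≤ r := by linarith
  have hs1 : 1 ≤ s := by linarith
  have hr' : (Real.conjExponent r).HolderConjugate r :=
    (Real.HolderConjugate.conjExponent (by linarith)).symm
  have hs' : (Real.conjExponent s).HolderConjugate s :=
    (Real.HolderConjugate.conjExponent (by linarith)).symm
  have hlt : Real.conjExponent s < Real.conjExponent r := by
    unfold Real.conjExponent
    rw [div_lt_div_iff₀ (by linarith) (by linarith)]
    linarith
  have hr2 : Real.conjExponent r ≤ 2 := by
    unfold Real.conjExponent
    rw [div_le_iff₀ (by linarith)]
    linarith
  -- Taking `ε = 1` gives the transpose norm at most 2.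
  obtain ⟨M, g, hg⟩ := exists_almost_isometric_embedding hs'.lt.le hlt hr2 N one_pos
  obtain ⟨Ψ, hΨm, hΨg, hΨ⟩ := exists_measurable_lift hr1 hs1
    (exists_lift_of_lrNorm_le hr' hs' fun a => (hg a).1)
  have hJ := lrNorm_transpose_le hr' hs' (by norm_num) fun a => (hg a).2
  have hfm : Measurable fun x k => f k x := measurable_pi_iff.2 fun k => (f k).measurable_coe
  let h : Fin M → Ω₂ → ℝ := fun j x => Ψ (fun k => f k x) j
  have hhm : ∀ j, Measurable (h j) := fun j => (measurable_pi_iff.1 hΨm j).comp hfm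
  have hn : varENorm q μ (ellrFun s h) ≤ 2 * varENorm q μ (ellrFun r fun k => f k) := by
    have e : (2 : ℝ≥0∞) = ‖(2 : ℝ)‖ₑ := by
      rw [Real.enorm_of_nonneg (by norm_num)]
      simp
    rw [e, ← varENorm_const_mul]
    refine varENorm_mono (Filter.Eventually.of_forall fun x => ?_)
    rw [abs_of_nonneg (ellrFun_nonneg _ _),
      abs_of_nonneg (mul_nonneg zero_le_two (ellrFun_nonneg _ _))]
    exact hΨ _
  have hfin : ∀ j, varENorm q μ (h j) < ∞ := fun j => by
    refine (varENorm_mono (Filter.Eventually.of_forall fun x => ?_)).trans_lt (hn.trans_lt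
      (ENNReal.mul_lt_top (by simp) (varENorm_ellrFun_lt_top hr1 f)))
    rw [abs_of_nonneg (ellrFun_nonneg _ _)]
    exact abs_le_lrNorm (by linarith) (fun j => h j x) j
  let H : Fin M → VarLp q μ := fun j => VarLp.ofFun (h j) (hhm j).aemeasurable (hfin j)
  have hH : ∀ j, (H j : Ω₂ → ℝ) =ᵐ[μ] h j := fun j => VarLp.coeFn_ofFun _ _ _
  have hfH : ∀ k, f k = ∑ j, g j k • H j := fun k => VarLp.ext_ae <| by
    filter_upwards [VarLp.coeFn_sum_smul Finset.univ (fun j => g j k) H, ae_all_iff.2 hH]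
      with x h1 h2
    rw [h1]
    simp only [h2]
    exact (hΨg (fun k => f k x) k).symm
  have hT : ∀ k, (T (f k) : Ω₁ → ℝ) =ᵐ[ν] fun x => ∑ j, g j k * T (H j) x := fun k => by
    rw [hfH, map_sum]
    simp only [map_smul]
    exact VarLp.coeFn_sum_smul Finset.univ (fun j => g j k) fun j => T (H j)
  have hleft : varENorm p ν (ellrFun r fun k => T (f k)) ≤
      2 * varENorm p ν (ellrFun s fun j => T (H j)) := by
    have e : (2 : ℝ≥0∞) = ‖(1 + 1 : ℝ)‖ₑ := by
      rw [Real.enorm_of_nonneg (by norm_num)]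
      norm_num
    rw [e, ← varENorm_const_mul]
    refine varENorm_mono ?_
    filter_upwards [ae_all_iff.2 hT] with x hx
    rw [abs_of_nonneg (ellrFun_nonneg _ _),
      abs_of_nonneg (mul_nonneg (by norm_num) (ellrFun_nonneg _ _)), ellrFun_apply]
    simp only [hx]
    exact hJ _
  calc varENorm p ν (ellrFun r fun k => T (f k))
      ≤ 2 * (C * ‖T‖ₑ * varENorm q μ (ellrFun s fun j => H j)) :=
        hleft.trans (mul_le_mul_right (hC T M H) _)
    _ = 2 * (C * ‖T‖ₑ * varENorm q μ (ellrFun s h)) := by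
        rw [varENorm_congr (ellrFun_congr hH)]
    _ ≤ 2 * (C * ‖T‖ₑ * (2 * varENorm q μ (ellrFun r fun k => f k))) := by gcongr
    _ = ((4 * C : ℝ≥0) : ℝ≥0∞) * ‖T‖ₑ * varENorm q μ (ellrFun r fun k => f k) := by
        push_cast
        ring

theorem mzConst_antitone_of_le_two {r s : ℝ} (hr : 1 ≤ r) (hrs : r < s) (hs2 : s ≤ 2) :
    mzConst μ ν q p s ≤ mzConst μ ν q p r := by
  refine le_iInf fun C => le_iInf fun hC => le_iInf fun hb => ?_
  refine ENNReal.le_of_forall_pos_le_add fun e he _ => ?_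
  have hC0 : 0 < C := one_pos.trans_le hC
  -- This `ε` turns the multiplicative loss into the additive error `e`.
  have h := hb.of_lt_of_le_two hr hrs hs2 (ε := e / C) (by positivity)
  have h1 : (1 + e / C) * C = C + e := by
    rw [add_mul, one_mul, div_mul_cancel₀ _ hC0.ne']
  rw [h1] at h
  rw [← ENNReal.coe_add]
  exact iInf_le_of_le (C + e) (iInf_le_of_le (hC.trans le_self_add) (iInf_le _ h))

end mz

theorem theorem2p1 {Ω₁ Ω₂ : Type*} [MeasurableSpace Ω₁] [MeasurableSpace Ω₂]
    (ν : Measure Ω₁) (μ : Measure Ω₂) [SigmaFinite ν] [SigmaFinite μ]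
    (p p₁ p₂ : VarExponent Ω₁) (hp : p.IsBdd ν) (hp₁ : p₁.IsBdd ν) (hp₂ : p₂.IsBdd ν)
    (q q₁ q₂ : VarExponent Ω₂) (hq₁ : q₁.IsBdd μ) (hq₂ : q₂.IsBdd μ) :
    (∀ r s : ℝ, 1 ≤ r → r < s → s ≤ 2 → mzConst μ ν q p s ≤ mzConst μ ν q p r) ∧
    (∀ r s : ℝ, 2 ≤ r → r < s → mzConst μ ν q p r ≤ 2 ^ 4 * mzConst μ ν q p s) ∧
    ((∀ᵐ x ∂ν, p₂ x ≤ p₁ x) →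
      ∀ r : ℝ, 1 ≤ r → mzConst μ ν q p₁ r ≤ (2 ^ 3 + 1) * mzConst μ ν q p₂ r) ∧
    ((∀ᵐ x ∂μ, q₁ x ≤ q₂ x) →
      ∀ r : ℝ, 1 ≤ r → mzConst μ ν q₁ p r ≤ (2 ^ 7 + 2 ^ 4) * mzConst μ ν q₂ p r) := by
  refine ⟨fun r s hr hrs hs => mzConst_antitone_of_le_two hr hrs hs, fun r s hr hrs => ?_,
    fun h r hr => ?_, fun h r hr => ?_⟩
  -- The constants obtained, 4, 3 and 2, lie below the stated 16, 9 and 144.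
  · refine (mzConst_le_mul (K := 4) (by norm_num) fun C hC => hC.of_two_le_of_lt hr hrs).trans ?_
    gcongr
    norm_num
  · refine (mzConst_le_mul (K := 3) (by norm_num) fun C hC =>
      hC.of_target_le hr hp₁ hp₂ h).trans ?_
    gcongr
    norm_num
  · refine (mzConst_le_mul (K := 2) (by norm_num) fun C hC =>
      hC.of_source_le hr hq₁ hq₂ h).trans ?_
    gcongr
    norm_num
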